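/- Let $M^n$ be a smooth Riemannian manifold with Levi-Civita connection $\nabla$, let $f\colon M^n\to\mathbb{R}^m$ be a smooth isometric immersion with normal bundle $N_fM$, normal connection $\nabla^\perp$ and second fundamental form $\alpha\colon TM\times TM\to N_fM$, let $\tilde\nabla$ be the flat connection of $\mathbb{R}^m$, and denote by $(\cdot)_{N_fM}$ the orthogonal projection onto the normal bundle. Let $\mathcal T$ be an infinitesimal bending of $f$, that is, a smooth section of $f^*T\mathbb{R}^m$ with $\langle\tilde\nabla_X\mathcal T,f_*Y\rangle+\langle f_*X,\tilde\nabla_Y\mathcal T\rangle=0$ for all $X,Y\in\mathfrak X(M)$. Put $LX=\tilde\nabla_X\mathcal T$ and $$\beta(X,Y)=\big(\tilde\nabla_XLY-L\nabla_XY\big)_{N_fM}.$$ For $\xi\in\Gamma(N_fM)$ define $A_\xi,B_\xi\in\Gamma(\mathrm{End}(TM))$ by $\langle A_\xi X,Y\rangle=\langle\alpha(X,Y),\xi\rangle$ and $\langle B_\xi X,Y\rangle=\langle\beta(X,Y),\xi\rangle$; define $\mathcal Y\eta$, tangent to $f$, by $\langle\mathcal Y\eta,f_*X\rangle+\langle\eta,LX\rangle=0$,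 and, identifying $TM$ with $f_*TM$, put $$\mathcal E(X,\eta)=\alpha(X,\mathcal Y\eta)+(LA_\eta X)_{N_fM}.$$ Then $\beta$ and $\mathcal E$ are smooth tensors, $\beta$ is symmetric, $\langle\mathcal E(X,\eta),\xi\rangle+\langle\mathcal E(X,\xi),\eta\rangle=0$, and for all $X,Y,Z\in\mathfrak X(M)$ and $\eta\in\Gamma(N_fM)$ $$A_{\beta(Y,Z)}X+B_{\alpha(Y,Z)}X=A_{\beta(X,Z)}Y+B_{\alpha(X,Z)}Y,\tag{1}$$ $$(\nabla^\perp_X\beta)(Y,Z)-(\nabla^\perp_Y\beta)(X,Z)=\mathcal E(Y,\alpha(X,Z))-\mathcal E(X,\alpha(Y,Z)),\tag{2}$$ $$(\nabla^\perp_X\mathcal E)(Y,\eta)-(\nabla^\perp_Y\mathcal E)(X,\eta)=\beta(X,A_\eta Y)-\beta(A_\eta X,Y)+\alpha(X,B_\eta Y)-\alpha(B_\eta X,Y).\tag{3}$$ Moreover, (2) for all $X,Y,Z$ is equivalent to $$(\nabla_XB_\eta)Y-(\nabla_YB_\eta)X-B_{\nabla^\perp_X\eta}Y+B_{\nabla^\perp_Y\eta}X=A_{\mathcal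 E(X,\eta)}Y-A_{\mathcal E(Y,\eta)}X\tag{4}$$ for all $X,Y\in\mathfrak X(M)$ and $\eta\in\Gamma(N_fM)$. This equivalence holds for every pair of smooth tensors $\beta\colon TM\times TM\to N_fM$, $\mathcal E\colon TM\times N_fM\to N_fM$ with $\beta$ symmetric and $\langle\mathcal E(X,\eta),\xi\rangle+\langle\mathcal E(X,\xi),\eta\rangle=0$ (with $B_\eta$ defined from $\beta$ as above), whether or not it is associated to a bending. -/

import Mathlib

open Bundle FiberBundle Module
open scoped Manifold ContDiff Bundle InnerProductSpace

noncomputable section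

namespace InfinitesimalBending

variable {n m : ℕ} {M : Type*} [TopologicalSpace M]
  [ChartedSpace (EuclideanSpace ℝ (Fin n)) M]

/-- Smooth tangent vector fields on `M`. -/
def IsSmoothField [IsManifold (𝓡 n) ∞ M] (X : ∀ x : M, TangentSpace (𝓡 n) x) : Prop :=
  ContMDiff (𝓡 n) (𝓡 n).tangent ∞ (fun x => (⟨x, X x⟩ : TangentBundle (𝓡 n) M))

/-! ### The Levi-Civita connection -/

section Riemannian

variable [RiemannianBundle (fun x : M => TangentSpace (𝓡 n) x)]

/-- The tangent vector `u` at `x` with `⟪u, w⟫ = φ w` for all `w`, for a linear functional `φ`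
(see `inner_riesz`). -/
def riesz {x : M} (φ : TangentSpace (𝓡 n) x → ℝ) : TangentSpace (𝓡 n) x :=
  haveI : FiniteDimensional ℝ (TangentSpace (𝓡 n) x) :=
    inferInstanceAs (FiniteDimensional ℝ (EuclideanSpace ℝ (Fin n)))
  ∑ i, φ (stdOrthonormalBasis ℝ (TangentSpace (𝓡 n) x) i) •
    stdOrthonormalBasis ℝ (TangentSpace (𝓡 n) x) i

theorem inner_riesz {x : M} {φ : TangentSpace (𝓡 n) x → ℝ} (hφ : IsLinearMap ℝ φ)
    (w : TangentSpace (𝓡 n) x) : ⟪riesz φ, w⟫_ℝ = φ w := by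
  have : FiniteDimensional ℝ (TangentSpace (𝓡 n) x) :=
    inferInstanceAs (FiniteDimensional ℝ (EuclideanSpace ℝ (Fin n)))
  have h := congrArg (IsLinearMap.mk' φ hφ)
    ((stdOrthonormalBasis ℝ (TangentSpace (𝓡 n) x)).sum_repr' w)
  simp only [map_sum, map_smul, IsLinearMap.mk'_apply] at h
  rw [← h, riesz, sum_inner]
  refine Finset.sum_congr rfl fun i _ => ?_
  rw [real_inner_smul_left, smul_eq_mul, mul_comm]

variable [IsManifold (𝓡 n) ∞ M]

/-- The right hand side of the Koszul formula for `⟪∇_X Y, Z⟫` at `x`. -/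
def koszul (X Y Z : ∀ x : M, TangentSpace (𝓡 n) x) (x : M) : ℝ :=
  (1 / 2 : ℝ) *
    (mvfderiv (𝓡 n) (fun y => ⟪Y y, Z y⟫_ℝ) x (X x)
      + mvfderiv (𝓡 n) (fun y => ⟪X y, Z y⟫_ℝ) x (Y x)
      - mvfderiv (𝓡 n) (fun y => ⟪X y, Y y⟫_ℝ) x (Z x)
      + ⟪VectorField.mlieBracket (𝓡 n) X Y x, Z x⟫_ℝ
      - ⟪VectorField.mlieBracket (𝓡 n) X Z x, Y x⟫_ℝ
      - ⟪VectorField.mlieBracket (𝓡 n) Y Z x, X x⟫_ℝ)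

/-- The Levi-Civita connection of `M`: the vector `∇_v Y` at `x`, for a tangent vector `v` at `x`
and a vector field `Y`, determined by the Koszul formula (which is tensorial in the first and the
third argument, so that `v` and the test vector `w` may be extended to arbitrary fields). -/
def leviCivita {x : M} (v : TangentSpace (𝓡 n) x) (Y : ∀ x : M, TangentSpace (𝓡 n) x) :
    TangentSpace (𝓡 n) x :=
  riesz fun w => koszul (extend (EuclideanSpace ℝ (Fin n)) v) Y
    (extend (EuclideanSpace ℝ (Fin n)) w) x

/-- A torsion free connection compatible with the metric is the one given by `leviCivita`. -/
theorem eq_leviCivita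
    [IsContMDiffRiemannianBundle (𝓡 n) 1 (EuclideanSpace ℝ (Fin n))
      (fun x : M => TangentSpace (𝓡 n) x)]
    (cov : CovariantDerivative (𝓡 n) (EuclideanSpace ℝ (Fin n))
      (TangentSpace (𝓡 n) : M → Type _))
    (htor : cov.torsion = 0) (hmet : cov.IsMetricCompatible)
    {x : M} (v : TangentSpace (𝓡 n) x) {Y : ∀ x : M, TangentSpace (𝓡 n) x}
    (hY : MDifferentiableAt (𝓡 n) (𝓡 n).tangent
      (fun x => (⟨x, Y x⟩ : TangentBundle (𝓡 n) M)) x) :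
    leviCivita v Y = cov Y x v := by
  have key : ∀ w : TangentSpace (𝓡 n) x, koszul (extend (EuclideanSpace ℝ (Fin n)) v) Y
      (extend (EuclideanSpace ℝ (Fin n)) w) x = ⟪cov Y x v, w⟫_ℝ := by
    intro w
    have hv := mdifferentiableAt_extend (𝓡 n) (EuclideanSpace ℝ (Fin n)) v
    have hw := mdifferentiableAt_extend (𝓡 n) (EuclideanSpace ℝ (Fin n)) w
    have h1 := hmet.mvfderiv_inner_eq (extend (EuclideanSpace ℝ (Fin n)) v) hY hw
    have h2 := hmet.mvfderiv_inner_eq Y hv hw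
    have h3 := hmet.mvfderiv_inner_eq (extend (EuclideanSpace ℝ (Fin n)) w) hv hY
    unfold koszul
    rw [h1, h2, h3, ← cov.torsion_eq_zero_iff.1 htor hv hY,
      ← cov.torsion_eq_zero_iff.1 htor hv hw, ← cov.torsion_eq_zero_iff.1 htor hY hw]
    simp only [inner_sub_left, extend_apply_self]
    simp only [real_inner_comm]
    ring
  unfold leviCivita
  simp only [key]
  refine ext_inner_right ℝ fun w => inner_riesz ?_ w
  exact ⟨fun a b => inner_add_right _ _ _, fun c a => real_inner_smul_right _ _ _⟩

end Riemannian

/-! ### Normal bundle and normal connection -/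

/-- The normal space `N_f M(x)`. -/
abbrev normalSpace (n : ℕ) {M : Type*} [TopologicalSpace M]
    [ChartedSpace (EuclideanSpace ℝ (Fin n)) M] (f : M → EuclideanSpace ℝ (Fin m)) (x : M) :
    Submodule ℝ (EuclideanSpace ℝ (Fin m)) :=
  (mvfderiv (𝓡 n) f x).rangeᗮ

variable (n) in
/-- The component `(u)_{N_f M}` of `u` in the normal space at `x`. -/
def normalPart (f : M → EuclideanSpace ℝ (Fin m)) (x : M) (u : EuclideanSpace ℝ (Fin m)) :
    normalSpace n f x :=
  (normalSpace n f x).orthogonalProjectionOnto u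

variable (n) in
/-- Smooth sections of the normal bundle. -/
def IsSmoothNormal (f : M → EuclideanSpace ℝ (Fin m)) (η : ∀ x, normalSpace n f x) : Prop :=
  ContMDiff (𝓡 n) 𝓘(ℝ, EuclideanSpace ℝ (Fin m)) ∞ (fun x => (η x : EuclideanSpace ℝ (Fin m)))

/-- The normal connection `∇^⊥_v η`. -/
def normalConn (f : M → EuclideanSpace ℝ (Fin m)) {x : M} (v : TangentSpace (𝓡 n) x)
    (η : ∀ x, normalSpace n f x) : normalSpace n f x :=
  normalPart n f x (mvfderiv (𝓡 n) (fun y => (η y : EuclideanSpace ℝ (Fin m))) x v)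

variable [IsManifold (𝓡 n) ∞ M]

/-- The second fundamental form `α(v, w) = (∇̃_v f_* W)_{N_f M}`, with `W` extending `w`. -/
def sff (f : M → EuclideanSpace ℝ (Fin m)) (x : M) (v w : TangentSpace (𝓡 n) x) :
    normalSpace n f x :=
  normalPart n f x
    (mvfderiv (𝓡 n) (fun y => mvfderiv (𝓡 n) f y (extend (EuclideanSpace ℝ (Fin n)) w y)) x v)

/-! ### Isometric immersions, infinitesimal bendings and the associated pair -/

variable (n) in
/-- Infinitesimal bendings of `f`. Sections of `f^* T ℝ^m` are maps into `ℝ^m`, and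
`∇̃_v 𝓣 = 𝓣_* v` is the derivative of `𝓣` along `v`. -/
structure IsBending (f T : M → EuclideanSpace ℝ (Fin m)) : Prop where
  smooth : ContMDiff (𝓡 n) 𝓘(ℝ, EuclideanSpace ℝ (Fin m)) ∞ T
  skew : ∀ (x : M) (v w : TangentSpace (𝓡 n) x),
    ⟪mvfderiv (𝓡 n) T x v, mvfderiv (𝓡 n) f x w⟫_ℝ
      + ⟪mvfderiv (𝓡 n) f x v, mvfderiv (𝓡 n) T x w⟫_ℝ = 0

variable [RiemannianBundle (fun x : M => TangentSpace (𝓡 n) x)]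

variable (n) in
/-- Smooth isometric immersions into Euclidean space. -/
structure IsIsometricImmersion (f : M → EuclideanSpace ℝ (Fin m)) : Prop where
  smooth : ContMDiff (𝓡 n) 𝓘(ℝ, EuclideanSpace ℝ (Fin m)) ∞ f
  inner_eq : ∀ (x : M) (v w : TangentSpace (𝓡 n) x),
    ⟪mvfderiv (𝓡 n) f x v, mvfderiv (𝓡 n) f x w⟫_ℝ = ⟪v, w⟫_ℝ

/-- For a tensor `b : TM × TM → N_f M`, the operator `S_ξ` with `⟪S_ξ v, w⟫ = ⟪b(v, w), ξ⟫`.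
It gives `A_ξ` for `b = α` and `B_ξ` for `b = β`. -/
def shape {f : M → EuclideanSpace ℝ (Fin m)}
    (b : ∀ x : M, TangentSpace (𝓡 n) x → TangentSpace (𝓡 n) x → normalSpace n f x)
    (x : M) (ξ : normalSpace n f x) (v : TangentSpace (𝓡 n) x) : TangentSpace (𝓡 n) x :=
  riesz fun w => ⟪b x v w, ξ⟫_ℝ

/-- `B(v, w) = (∇̃_v L) W = ∇̃_v (L W) - L ∇_v W`, with `L = 𝓣_*` and `W` extending `w`. -/
def hessBending (T : M → EuclideanSpace ℝ (Fin m)) (x : M) (v w : TangentSpace (𝓡 n) x) :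
    EuclideanSpace ℝ (Fin m) :=
  mvfderiv (𝓡 n) (fun y => mvfderiv (𝓡 n) T y (extend (EuclideanSpace ℝ (Fin n)) w y)) x v
    - mvfderiv (𝓡 n) T x (leviCivita v (extend (EuclideanSpace ℝ (Fin n)) w))

variable (n) in
/-- `β(v, w) = (B(v, w))_{N_f M}`. -/
def beta (f T : M → EuclideanSpace ℝ (Fin m)) (x : M) (v w : TangentSpace (𝓡 n) x) :
    normalSpace n f x :=
  normalPart n f x (hessBending T x v w)

/-- The tangent vector `u` with `f_* u = 𝓨 η`, that is, `⟪u, w⟫ = -⟪η, L w⟫` for all `w`. -/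
def calY (f T : M → EuclideanSpace ℝ (Fin m)) (x : M) (η : normalSpace n f x) :
    TangentSpace (𝓡 n) x :=
  riesz fun w => -⟪(η : EuclideanSpace ℝ (Fin m)), mvfderiv (𝓡 n) T x w⟫_ℝ

variable (n) in
/-- `𝓔(v, η) = α(v, 𝓨 η) + (L A_η v)_{N_f M}`. -/
def calE (f T : M → EuclideanSpace ℝ (Fin m)) (x : M) (v : TangentSpace (𝓡 n) x)
    (η : normalSpace n f x) : normalSpace n f x :=
  sff f x v (calY f T x η) + normalPart n f x (mvfderiv (𝓡 n) T x (shape (sff f) x η v))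

/-! ### The fundamental system for a pair `(b, e)` -/

section System

variable {f : M → EuclideanSpace ℝ (Fin m)}
  (b : ∀ x : M, TangentSpace (𝓡 n) x → TangentSpace (𝓡 n) x → normalSpace n f x)
  (e : ∀ x : M, TangentSpace (𝓡 n) x → normalSpace n f x → normalSpace n f x)

/-- Smooth tensors `b : TM × TM → N_f M` and `e : TM × N_f M → N_f M` with `b` symmetric and
`⟪e(X, η), ξ⟫ + ⟪e(X, ξ), η⟫ = 0`. -/
structure IsCompatiblePair : Prop where
  bilin_b : ∀ x, IsBilinearMap ℝ (b x)
  bilin_e : ∀ x, IsBilinearMap ℝ (e x)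
  smooth_b : ∀ X Y : (∀ x : M, TangentSpace (𝓡 n) x), IsSmoothField X → IsSmoothField Y →
    IsSmoothNormal n f (fun x => b x (X x) (Y x))
  smooth_e : ∀ (X : ∀ x : M, TangentSpace (𝓡 n) x) (η : ∀ x, normalSpace n f x),
    IsSmoothField X → IsSmoothNormal n f η → IsSmoothNormal n f (fun x => e x (X x) (η x))
  symm : ∀ x v w, b x v w = b x w v
  anti : ∀ x v η ξ, ⟪e x v η, ξ⟫_ℝ + ⟪e x v ξ, η⟫_ℝ = 0

/-- `(∇^⊥_X b)(Y, Z)`. -/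
def covB (X Y Z : ∀ x : M, TangentSpace (𝓡 n) x) (x : M) : normalSpace n f x :=
  normalConn f (X x) (fun y => b y (Y y) (Z y)) - b x (leviCivita (X x) Y) (Z x)
    - b x (Y x) (leviCivita (X x) Z)

/-- `(∇^⊥_X e)(Y, η)`. -/
def covE (X Y : ∀ x : M, TangentSpace (𝓡 n) x) (η : ∀ x, normalSpace n f x) (x : M) :
    normalSpace n f x :=
  normalConn f (X x) (fun y => e y (Y y) (η y)) - e x (leviCivita (X x) Y) (η x)
    - e x (Y x) (normalConn f (X x) η)

/-- `(∇_X S_η) Y`, where `⟪S_η Y, Z⟫ = ⟪b(Y, Z), η⟫`. -/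
def covShape (X Y : ∀ x : M, TangentSpace (𝓡 n) x) (η : ∀ x, normalSpace n f x) (x : M) :
    TangentSpace (𝓡 n) x :=
  leviCivita (X x) (fun y => shape b y (η y) (Y y)) - shape b x (η x) (leviCivita (X x) Y)

def GaussEq : Prop :=
  ∀ X Y Z : (∀ x : M, TangentSpace (𝓡 n) x),
    IsSmoothField X → IsSmoothField Y → IsSmoothField Z → ∀ x : M,
    shape (sff f) x (b x (Y x) (Z x)) (X x) + shape b x (sff f x (Y x) (Z x)) (X x)
      = shape (sff f) x (b x (X x) (Z x)) (Y x) + shape b x (sff f x (X x) (Z x)) (Y x)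

def CodazziEq : Prop :=
  ∀ X Y Z : (∀ x : M, TangentSpace (𝓡 n) x),
    IsSmoothField X → IsSmoothField Y → IsSmoothField Z → ∀ x : M,
    covB b X Y Z x - covB b Y X Z x
      = e x (Y x) (sff f x (X x) (Z x)) - e x (X x) (sff f x (Y x) (Z x))

def RicciEq : Prop :=
  ∀ (X Y : ∀ x : M, TangentSpace (𝓡 n) x) (η : ∀ x, normalSpace n f x),
    IsSmoothField X → IsSmoothField Y → IsSmoothNormal n f η → ∀ x : M,
    covE e X Y η x - covE e Y X η x
      = b x (X x) (shape (sff f) x (η x) (Y x)) - b x (shape (sff f) x (η x) (X x)) (Y x)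
        + sff f x (X x) (shape b x (η x) (Y x)) - sff f x (shape b x (η x) (X x)) (Y x)

/-- The Codazzi equation in terms of the operators `S_η` of `b`. -/
def CodazziShapeEq : Prop :=
  ∀ (X Y : ∀ x : M, TangentSpace (𝓡 n) x) (η : ∀ x, normalSpace n f x),
    IsSmoothField X → IsSmoothField Y → IsSmoothNormal n f η → ∀ x : M,
    covShape b X Y η x - covShape b Y X η x
        - shape b x (normalConn f (X x) η) (Y x) + shape b x (normalConn f (Y x) η) (X x)
      = shape (sff f) x (e x (X x) (η x)) (Y x) - shape (sff f) x (e x (Y x) (η x)) (X x)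

end System

end InfinitesimalBending

end

open InfinitesimalBending

open Bundle FiberBundle Module
open scoped Manifold ContDiff Bundle InnerProductSpace

noncomputable section

namespace InfinitesimalBending

/-! ### Differential calculus of vector-valued maps on `M`, in charts. -/

section Calculus

variable {n : ℕ} {M : Type*} [TopologicalSpace M] [ChartedSpace (EuclideanSpace ℝ (Fin n)) M]
  {V W : Type*} [NormedAddCommGroup V] [NormedSpace ℝ V] [NormedAddCommGroup W] [NormedSpace ℝ W]

/-! A bending is an infinitesimal rotation that varies from point to point. Extend `L = 𝓣_*` from
the tangent space to all of `ℝ^m` by `𝓨` on the normal space. The result `J` (`rotation`) is a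
smooth map from `M` to the skew-symmetric endomorphisms of the fixed space `ℝ^m`, and `𝓣_* = J ∘
f_*`. The pair `(β, 𝓔)` is its differential in disguise: `dJ(X) f_*Y = β(X, Y)` and `dJ(X) η = -f_*
B_η X + 𝓔(X, η)` (`mvfderiv_rotation_mvfderiv`, `mvfderiv_rotation_normal`). In the first formula
the tangential part vanishes because `⟪dJ(X) f_*Y, f_*Z⟫` is symmetric in `X, Y` and skew in `Y, Z`.
Tensoriality, smoothness and the antisymmetry of `𝓔` can all be read off from `dJ`.

The three equations say that `dJ` is closed: `X(dJ(Y)) - Y(dJ(X)) = dJ([X, Y])`, with `[X, Y] = ∇_X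
Y - ∇_Y X`. Applied to `f_*Z`, and expanded by the Gauss and Weingarten formulas, the tangential
part of this identity is (1) and the normal part is (2). Applied to `η`, its normal part is (3).

The equivalence of (2) and (4) is duality: pair (2) with `η` and (4) with `Z`, and the two scalars
agree (`inner_codazzi`) by metric compatibility and the antisymmetry of `𝓔`. Since every tangent or
normal vector is a value of a global smooth section, the pairings lose nothing. -/

theorem differentiableAt_comp_extChartAt_symm {g : M → V} {x : M}
    (hg : MDifferentiableAt (𝓡 n) 𝓘(ℝ, V) g x) :
    DifferentiableAt ℝ (g ∘ (extChartAt (𝓡 n) x).symm) (extChartAt (𝓡 n) x x) := by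
  have h := hg.differentiableWithinAt_writtenInExtChartAt
  rw [ModelWithCorners.range_eq_univ, differentiableWithinAt_univ] at h
  exact h

theorem mvfderiv_apply_eq_fderiv {g : M → V} {x : M}
    (hg : MDifferentiableAt (𝓡 n) 𝓘(ℝ, V) g x) (v : TangentSpace (𝓡 n) x) :
    mvfderiv (𝓡 n) g x v =
      fderiv ℝ (g ∘ (extChartAt (𝓡 n) x).symm) (extChartAt (𝓡 n) x x) v := by
  rw [hg.mvfderiv, ModelWithCorners.range_eq_univ, fderivWithin_univ]
  rfl

theorem mvfderiv_clm_apply {A : M → V →L[ℝ] W} {u : M → V} {x : M}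
    (hA : MDifferentiableAt (𝓡 n) 𝓘(ℝ, V →L[ℝ] W) A x)
    (hu : MDifferentiableAt (𝓡 n) 𝓘(ℝ, V) u x) (v : TangentSpace (𝓡 n) x) :
    mvfderiv (𝓡 n) (fun y => A y (u y)) x v =
      mvfderiv (𝓡 n) A x v (u x) + A x (mvfderiv (𝓡 n) u x v) := by
  have key (w : EuclideanSpace ℝ (Fin n)) := DFunLike.congr_fun
    (fderiv_clm_apply (differentiableAt_comp_extChartAt_symm hA)
      (differentiableAt_comp_extChartAt_symm hu)) w
  simp only [Function.comp_apply, extChartAt_to_inv, _root_.add_apply,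
    ContinuousLinearMap.comp_apply, ContinuousLinearMap.flip_apply] at key
  rw [mvfderiv_apply_eq_fderiv hA, mvfderiv_apply_eq_fderiv hu,
    mvfderiv_apply_eq_fderiv (hA.clm_apply hu)]
  exact (key v).trans (add_comm _ _)

theorem mdifferentiableAt_inner {V : Type*} [NormedAddCommGroup V] [InnerProductSpace ℝ V]
    {u w : M → V} {x : M} (hu : MDifferentiableAt (𝓡 n) 𝓘(ℝ, V) u x)
    (hw : MDifferentiableAt (𝓡 n) 𝓘(ℝ, V) w x) :
    MDifferentiableAt (𝓡 n) 𝓘(ℝ, ℝ) (fun y => ⟪u y, w y⟫_ℝ) x :=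
  ((contDiff_inner (𝕜 := ℝ) (E := V) (n := 1)).contMDiff.mdifferentiable one_ne_zero
    (u x, w x)).comp x (hu.prodMk_space hw)

theorem mvfderiv_inner {V : Type*} [NormedAddCommGroup V] [InnerProductSpace ℝ V]
    {u w : M → V} {x : M} (hu : MDifferentiableAt (𝓡 n) 𝓘(ℝ, V) u x)
    (hw : MDifferentiableAt (𝓡 n) 𝓘(ℝ, V) w x) (v : TangentSpace (𝓡 n) x) :
    mvfderiv (𝓡 n) (fun y => ⟪u y, w y⟫_ℝ) x v =
      ⟪mvfderiv (𝓡 n) u x v, w x⟫_ℝ + ⟪u x, mvfderiv (𝓡 n) w x v⟫_ℝ := by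
  have key (z : EuclideanSpace ℝ (Fin n)) := fderiv_inner_apply ℝ
    (differentiableAt_comp_extChartAt_symm hu) (differentiableAt_comp_extChartAt_symm hw) z
  simp only [Function.comp_apply, extChartAt_to_inv] at key
  rw [mvfderiv_apply_eq_fderiv hu, mvfderiv_apply_eq_fderiv hw,
    mvfderiv_apply_eq_fderiv (mdifferentiableAt_inner hu hw)]
  exact (key v).trans (add_comm _ _)

variable [IsManifold (𝓡 n) ∞ M]

/-- Composing with the trivialization at `x` turns `g_*`, whose domain varies with the point, into a
map into a fixed space of operators, where smoothness can be stated and used. -/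
theorem contMDiffAt_mvfderiv_comp_symmL {g : M → V} (x : M)
    (hg : ContMDiff (𝓡 n) 𝓘(ℝ, V) ∞ g) :
    ContMDiffAt (𝓡 n) 𝓘(ℝ, EuclideanSpace ℝ (Fin n) →L[ℝ] V) ∞
      (fun y => (mvfderiv (𝓡 n) g y) ∘L
        ((trivializationAt (EuclideanSpace ℝ (Fin n)) (TangentSpace (𝓡 n)) x).symmL ℝ y)) x := by
  have h := (hg.contMDiffAt (x := x)).mfderiv_const (m := ∞) le_rfl
  refine h.congr_of_eventuallyEq ?_
  filter_upwards [(chartAt (EuclideanSpace ℝ (Fin n)) x).open_source.mem_nhds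
    (mem_chart_source _ x)] with y hy
  rw [TangentBundle.symmL_trivializationAt_eq_core hy]
  refine Eq.trans ?_ (inTangentCoordinates_eq (I := 𝓡 n) (I' := 𝓘(ℝ, V)) id g
    (fun y => mfderiv (𝓡 n) 𝓘(ℝ, V) g y) (x₀ := x) (x := y) hy
    (Set.mem_univ _)).symm
  rw [tangentBundleCore_coordChange_model_space, ContinuousLinearMap.id_comp]
  rfl

theorem symmL_trivializationAt_injective {x y : M}
    (hy : y ∈ (trivializationAt (EuclideanSpace ℝ (Fin n)) (TangentSpace (𝓡 n)) x).baseSet) :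
    Function.Injective
      ((trivializationAt (EuclideanSpace ℝ (Fin n)) (TangentSpace (𝓡 n)) x).symmL ℝ y) := by
  intro a b h
  have key (c : EuclideanSpace ℝ (Fin n)) := Trivialization.continuousLinearMapAt_symmL
    (R := ℝ) (trivializationAt (EuclideanSpace ℝ (Fin n)) (TangentSpace (𝓡 n)) x) hy c
  rw [← key a, h, key]

theorem eventually_symmL_trivializationAt (x : M) (Z : ∀ x : M, TangentSpace (𝓡 n) x) :
    ∀ᶠ y in nhds x,
      (trivializationAt (EuclideanSpace ℝ (Fin n)) (TangentSpace (𝓡 n)) x).symmL ℝ y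
        (trivializationAt (EuclideanSpace ℝ (Fin n)) (TangentSpace (𝓡 n)) x ⟨y, Z y⟩).2 = Z y := by
  filter_upwards [(trivializationAt (EuclideanSpace ℝ (Fin n)) (TangentSpace (𝓡 n)) x
    ).open_baseSet.mem_nhds (mem_baseSet_trivializationAt' x)] with y hy
  rw [Trivialization.symmL_apply]
  · exact Trivialization.symm_apply_apply_mk _ hy (Z y)
  · exact hy

theorem mdifferentiableAt_mvfderiv_apply {g : M → V} {Z : ∀ x : M, TangentSpace (𝓡 n) x} {x : M}
    (hg : ContMDiff (𝓡 n) 𝓘(ℝ, V) ∞ g)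
    (hZ : MDifferentiableAt (𝓡 n) (𝓡 n).tangent
      (fun x => (⟨x, Z x⟩ : TangentBundle (𝓡 n) M)) x) :
    MDifferentiableAt (𝓡 n) 𝓘(ℝ, V) (fun y => mvfderiv (𝓡 n) g y (Z y)) x := by
  have h1 := (contMDiffAt_mvfderiv_comp_symmL x hg).mdifferentiableAt (by simp)
  have h2 := (mdifferentiableAt_section (𝓡 n) Z).1 hZ
  refine (h1.clm_apply h2).congr_of_eventuallyEq ?_
  filter_upwards [eventually_symmL_trivializationAt x Z] with y hy
  rw [ContinuousLinearMap.comp_apply, hy]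

theorem contMDiff_mvfderiv_apply {g : M → V} {Z : ∀ x : M, TangentSpace (𝓡 n) x}
    (hg : ContMDiff (𝓡 n) 𝓘(ℝ, V) ∞ g) (hZ : IsSmoothField Z) :
    ContMDiff (𝓡 n) 𝓘(ℝ, V) ∞ (fun y => mvfderiv (𝓡 n) g y (Z y)) := by
  intro x
  have h2 := (contMDiffAt_section x).1 (hZ x)
  refine ((contMDiffAt_mvfderiv_comp_symmL x hg).clm_apply h2).congr_of_eventuallyEq ?_
  filter_upwards [eventually_symmL_trivializationAt x Z] with y hy
  rw [ContinuousLinearMap.comp_apply, hy]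

/-- In a chart this is the symmetry of the second derivative of `g`. The fields need only be
differentiable at `x`, so that the local extensions `extend` are admissible. The target `V` is
arbitrary, so the lemma serves `f`, `𝓣` and the operator-valued `J` alike. -/
theorem mvfderiv_mlieBracket {g : M → V} {X Y : ∀ x : M, TangentSpace (𝓡 n) x} {x : M}
    (hg : ContMDiff (𝓡 n) 𝓘(ℝ, V) ∞ g)
    (hX : MDifferentiableAt (𝓡 n) (𝓡 n).tangent
      (fun x => (⟨x, X x⟩ : TangentBundle (𝓡 n) M)) x)
    (hY : MDifferentiableAt (𝓡 n) (𝓡 n).tangent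
      (fun x => (⟨x, Y x⟩ : TangentBundle (𝓡 n) M)) x) :
    mvfderiv (𝓡 n) g x (VectorField.mlieBracket (𝓡 n) X Y x) =
      mvfderiv (𝓡 n) (fun y => mvfderiv (𝓡 n) g y (Y y)) x (X x)
        - mvfderiv (𝓡 n) (fun y => mvfderiv (𝓡 n) g y (X y)) x (Y x) := by
  set φ := extChartAt (𝓡 n) x with hφ
  have hU : IsOpen φ.target := isOpen_extChartAt_target x
  have hz : φ x ∈ φ.target := mem_extChartAt_target x
  let pull (Z : ∀ x : M, TangentSpace (𝓡 n) x) : EuclideanSpace ℝ (Fin n) →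
    EuclideanSpace ℝ (Fin n) := VectorField.mpullbackWithin 𝓘(ℝ, EuclideanSpace ℝ (Fin n)) (𝓡 n)
      φ.symm Z (Set.range (𝓡 n))
  have hgs : ContDiffOn ℝ ∞ (g ∘ φ.symm) φ.target :=
    (hg.comp_contMDiffOn (contMDiffOn_extChartAt_symm x)).contDiffOn
  have hgd (z : EuclideanSpace ℝ (Fin n)) (hz : z ∈ φ.target) : ContDiffAt ℝ ∞ (g ∘ φ.symm) z :=
    hgs.contDiffAt (hU.mem_nhds hz)
  -- Chain rule: `g_* Z` read in the chart is the derivative of `g ∘ φ.symm` along the pulled back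
  -- field.
  have hpush (Z : ∀ x : M, TangentSpace (𝓡 n) x) (z : EuclideanSpace ℝ (Fin n))
      (hz : z ∈ φ.target) :
      mvfderiv (𝓡 n) g (φ.symm z) (Z (φ.symm z)) = fderiv ℝ (g ∘ φ.symm) z (pull Z z) := by
    have hinv := isInvertible_mfderivWithin_extChartAt_symm (I := 𝓡 n) hz
    have hcomp := mfderiv_comp_mfderivWithin z
      ((hg.contMDiffAt (x := φ.symm z)).mdifferentiableAt (by simp))
      (mdifferentiableWithinAt_extChartAt_symm (I := 𝓡 n) hz)
      ((𝓡 n).uniqueMDiffOn z (by simp))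
    rw [mfderivWithin_eq_fderivWithin] at hcomp
    have hr : fderivWithin ℝ (g ∘ φ.symm) (Set.range (𝓡 n)) z = fderiv ℝ (g ∘ φ.symm) z := by
      rw [ModelWithCorners.range_eq_univ, fderivWithin_univ]
    have h2 := DFunLike.congr_fun (hr.symm.trans hcomp) (pull Z z)
    refine Eq.trans ?_ h2.symm
    have h3 := hinv.self_apply_inverse (Z (φ.symm z))
    exact (congrArg (mvfderiv (𝓡 n) g (φ.symm z)) h3).symm
  have hpull0 (Z : ∀ x : M, TangentSpace (𝓡 n) x) : pull Z (φ x) = Z x := by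
    have h : pull Z (φ x) = ((mfderivWithin 𝓘(ℝ, EuclideanSpace ℝ (Fin n)) (𝓡 n) φ.symm
      (Set.range (𝓡 n)) (φ x)).inverse (Z (φ.symm (φ x)))) := rfl
    rw [h]
    have h2 : φ.symm (φ x) = x := extChartAt_to_inv x
    rw [h2]
    exact mfderivWithin_extChartAt_symm_inverse_apply (I := 𝓡 n) (Z x)
  have hpulld {Z : ∀ x : M, TangentSpace (𝓡 n) x} (hZ : MDifferentiableAt (𝓡 n) (𝓡 n).tangent
      (fun x => (⟨x, Z x⟩ : TangentBundle (𝓡 n) M)) x) :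
      DifferentiableAt ℝ (pull Z) (φ x) := by
    have h := (mdifferentiableWithinAt_univ.2 hZ).differentiableWithinAt_mpullbackWithin_vectorField
    rw [Set.preimage_univ, Set.univ_inter] at h
    have hr : (Set.range (𝓡 n)) ∈ nhds (φ x) := by simp
    exact h.differentiableAt hr
  have hdd : DifferentiableAt ℝ (fderiv ℝ (g ∘ φ.symm)) (φ x) :=
    ((hgd _ hz).fderiv_right (m := 1) (ENat.LEInfty.out : (2 : ℕ∞ω) ≤ ∞)).differentiableAt one_ne_zero
  have hder {Z : ∀ x : M, TangentSpace (𝓡 n) x} (hZ : MDifferentiableAt (𝓡 n) (𝓡 n).tangent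
      (fun x => (⟨x, Z x⟩ : TangentBundle (𝓡 n) M)) x) (v : TangentSpace (𝓡 n) x) :
      mvfderiv (𝓡 n) (fun y => mvfderiv (𝓡 n) g y (Z y)) x v =
        fderiv ℝ (fderiv ℝ (g ∘ φ.symm)) (φ x) v (pull Z (φ x))
          + fderiv ℝ (g ∘ φ.symm) (φ x) (fderiv ℝ (pull Z) (φ x) v) := by
    have hZg := mdifferentiableAt_mvfderiv_apply hg hZ
    have hev : (fun y => mvfderiv (𝓡 n) g y (Z y)) ∘ φ.symm =ᶠ[nhds (φ x)]
        fun z => fderiv ℝ (g ∘ φ.symm) z (pull Z z) := by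
      filter_upwards [hU.mem_nhds hz] with z hz
      exact hpush Z z hz
    rw [mvfderiv_apply_eq_fderiv hZg, ← hφ, hev.fderiv_eq, fderiv_clm_apply hdd (hpulld hZ)]
    exact add_comm _ _
  have hsymm : IsSymmSndFDerivAt ℝ (g ∘ φ.symm) (φ x) :=
    (hgd _ hz).isSymmSndFDerivAt (by simpa using (ENat.LEInfty.out : (2 : ℕ∞ω) ≤ ∞))
  have hbr : VectorField.mlieBracket (𝓡 n) X Y x =
      (fderiv ℝ (pull Y) (φ x) (pull X (φ x)) - fderiv ℝ (pull X) (φ x) (pull Y (φ x)) :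
        EuclideanSpace ℝ (Fin n)) := by
    have h := VectorField.mlieBracketWithin_apply (I := 𝓡 n) (V := X) (W := Y) (s := Set.univ)
      (x₀ := x)
    rw [VectorField.mlieBracketWithin_univ, mfderiv_extChartAt_self] at h
    refine h.trans ((DFunLike.congr_fun ContinuousLinearMap.inverse_id _).trans ?_)
    have hr : φ.symm ⁻¹' Set.univ ∩ Set.range (𝓡 n) = Set.univ := by simp
    have h2 := congrArg (fun s => VectorField.lieBracketWithin ℝ (pull X) (pull Y) s (φ x)) hr
    refine h2.trans ?_
    simp only [VectorField.lieBracketWithin_univ]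
    rfl
  have hL := hpush (VectorField.mlieBracket (𝓡 n) X Y) (φ x) hz
  rw [hpull0, show φ.symm (φ x) = x from extChartAt_to_inv x] at hL
  rw [hL, hder hX, hder hY, hbr, ← hpull0 X, ← hpull0 Y, map_sub,
    hsymm (pull X (φ x)) (pull Y (φ x))]
  abel

end Calculus

theorem contDiff_adjoint {V W : Type*} [NormedAddCommGroup V] [InnerProductSpace ℝ V]
    [CompleteSpace V] [NormedAddCommGroup W] [InnerProductSpace ℝ W] [CompleteSpace W] {k : ℕ∞ω} :
    ContDiff ℝ k (fun A : V →L[ℝ] W => ContinuousLinearMap.adjoint A) := by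
  let L : (V →L[ℝ] W) →L[ℝ] (W →L[ℝ] V) :=
    { toFun := fun A => ContinuousLinearMap.adjoint A
      map_add' := fun A B => map_add _ A B
      map_smul' := fun c A => by simp
      cont := (ContinuousLinearMap.adjoint (𝕜 := ℝ) (E := V) (F := W)).continuous }
  exact L.contDiff

/-! ### The adjoint of `f_*`, the tangential projection, and their smoothness. -/

section Projection

variable {n m : ℕ} {M : Type*} [TopologicalSpace M]
  [ChartedSpace (EuclideanSpace ℝ (Fin n)) M]
  [RiemannianBundle (fun x : M => TangentSpace (𝓡 n) x)]

theorem riesz_eq {x : M} {φ : TangentSpace (𝓡 n) x → ℝ} {u : TangentSpace (𝓡 n) x}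
    (h : ∀ w, ⟪u, w⟫_ℝ = φ w) : riesz φ = u := by
  have hφ : IsLinearMap ℝ φ :=
    ⟨fun a b => by simp only [← h, inner_add_right],
      fun c a => by simp only [← h, real_inner_smul_right, smul_eq_mul]⟩
  exact ext_inner_right ℝ fun w => by rw [inner_riesz hφ, h]

variable (n) in
/-- The adjoint `ℝ^m → T_x M` of the differential of `f`. -/
def pullTangent (f : M → EuclideanSpace ℝ (Fin m)) (x : M) :
    EuclideanSpace ℝ (Fin m) →ₗ[ℝ] TangentSpace (𝓡 n) x where
  toFun u := riesz fun w => ⟪u, mvfderiv (𝓡 n) f x w⟫_ℝ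
  map_add' u u' := riesz_eq fun w => by
    have h (u : EuclideanSpace ℝ (Fin m)) : IsLinearMap ℝ fun w : TangentSpace (𝓡 n) x =>
      ⟪u, mvfderiv (𝓡 n) f x w⟫_ℝ := ⟨fun a b => by rw [map_add, inner_add_right],
        fun c a => by rw [map_smul, real_inner_smul_right, smul_eq_mul]⟩
    rw [inner_add_left, inner_riesz (h u), inner_riesz (h u'), inner_add_left]
  map_smul' c u := riesz_eq fun w => by
    have h (u : EuclideanSpace ℝ (Fin m)) : IsLinearMap ℝ fun w : TangentSpace (𝓡 n) x =>
      ⟪u, mvfderiv (𝓡 n) f x w⟫_ℝ := ⟨fun a b => by rw [map_add, inner_add_right],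
        fun c a => by rw [map_smul, real_inner_smul_right, smul_eq_mul]⟩
    rw [RingHom.id_apply, real_inner_smul_left, inner_riesz (h u), real_inner_smul_left]

theorem inner_pullTangent (f : M → EuclideanSpace ℝ (Fin m)) (x : M)
    (u : EuclideanSpace ℝ (Fin m)) (w : TangentSpace (𝓡 n) x) :
    ⟪pullTangent n f x u, w⟫_ℝ = ⟪u, mvfderiv (𝓡 n) f x w⟫_ℝ :=
  inner_riesz (φ := fun w => ⟪u, mvfderiv (𝓡 n) f x w⟫_ℝ)
    ⟨fun a b => by rw [map_add, inner_add_right],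
      fun c a => by rw [map_smul, real_inner_smul_right, smul_eq_mul]⟩ w

variable (n) in
/-- The endomorphism `g_* ∘ (f_*)^*` of `ℝ^m` at `x`. For `g = f` it is the orthogonal projection
onto the tangent space of an isometric immersion `f`. -/
def pushPull (f g : M → EuclideanSpace ℝ (Fin m)) (x : M) :
    EuclideanSpace ℝ (Fin m) →L[ℝ] EuclideanSpace ℝ (Fin m) :=
  LinearMap.toContinuousLinearMap ((mvfderiv (𝓡 n) g x).toLinearMap ∘ₗ pullTangent n f x)

theorem pushPull_apply (f g : M → EuclideanSpace ℝ (Fin m)) (x : M)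
    (u : EuclideanSpace ℝ (Fin m)) :
    pushPull n f g x u = mvfderiv (𝓡 n) g x (pullTangent n f x u) := rfl

variable {f : M → EuclideanSpace ℝ (Fin m)}

theorem IsIsometricImmersion.pullTangent_mvfderiv (hf : IsIsometricImmersion n f) (x : M)
    (v : TangentSpace (𝓡 n) x) : pullTangent n f x (mvfderiv (𝓡 n) f x v) = v :=
  riesz_eq fun w => (hf.inner_eq x v w).symm

theorem IsIsometricImmersion.injective (hf : IsIsometricImmersion n f) (x : M) :
    Function.Injective (mvfderiv (𝓡 n) f x) := fun v w h => by
  rw [← hf.pullTangent_mvfderiv x v, h, hf.pullTangent_mvfderiv]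

variable [IsManifold (𝓡 n) ∞ M]

variable (n) in
/-- The differential of `f` in the coordinates at `x`. -/
def localDeriv (f : M → EuclideanSpace ℝ (Fin m)) (x y : M) :
    EuclideanSpace ℝ (Fin n) →L[ℝ] EuclideanSpace ℝ (Fin m) :=
  (mvfderiv (𝓡 n) f y) ∘L
    ((trivializationAt (EuclideanSpace ℝ (Fin n)) (TangentSpace (𝓡 n)) x).symmL ℝ y)

variable (n) in
/-- The map `pullTangent n f y` in the coordinates at `x`. -/
def localPull (f : M → EuclideanSpace ℝ (Fin m)) (x y : M) :
    EuclideanSpace ℝ (Fin m) →L[ℝ] EuclideanSpace ℝ (Fin n) :=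
  Ring.inverse (ContinuousLinearMap.adjoint (localDeriv n f x y) ∘L localDeriv n f x y) ∘L
    ContinuousLinearMap.adjoint (localDeriv n f x y)

/-- An element of the kernel of `F^* F` is killed by `F`, hence is zero as `f_*` is injective; in
finite dimension this gives invertibility. -/
theorem IsIsometricImmersion.isUnit_gram (hf : IsIsometricImmersion n f) {x y : M}
    (hy : y ∈ (trivializationAt (EuclideanSpace ℝ (Fin n)) (TangentSpace (𝓡 n)) x).baseSet) :
    IsUnit (ContinuousLinearMap.adjoint (localDeriv n f x y) ∘L localDeriv n f x y) := by
  rw [ContinuousLinearMap.isUnit_iff_isUnit_toLinearMap, LinearMap.isUnit_iff_ker_eq_bot,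
    LinearMap.ker_eq_bot']
  intro c hc
  have hc' : ContinuousLinearMap.adjoint (localDeriv n f x y) (localDeriv n f x y c) = 0 := hc
  have h0 : ⟪localDeriv n f x y c, localDeriv n f x y c⟫_ℝ = 0 := by
    rw [← ContinuousLinearMap.adjoint_inner_left, hc', inner_zero_left]
  rw [inner_self_eq_zero] at h0
  refine symmL_trivializationAt_injective hy (hf.injective y ?_)
  rw [map_zero, map_zero]
  exact h0

/-- The coordinate frame need not be orthonormal, so the coordinates `c` of the tangential part of
`u` come from the normal equations `F^* F c = F^* u`. `Ring.inverse` is a true inverse here because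
the Gram operator is a unit over the base set. -/
theorem IsIsometricImmersion.trivializationAt_pullTangent (hf : IsIsometricImmersion n f) {x y : M}
    (hy : y ∈ (trivializationAt (EuclideanSpace ℝ (Fin n)) (TangentSpace (𝓡 n)) x).baseSet)
    (u : EuclideanSpace ℝ (Fin m)) :
    (trivializationAt (EuclideanSpace ℝ (Fin n)) (TangentSpace (𝓡 n)) x
      ⟨y, pullTangent n f y u⟩).2 = localPull n f x y u := by
  set c := (trivializationAt (EuclideanSpace ℝ (Fin n)) (TangentSpace (𝓡 n)) x
      ⟨y, pullTangent n f y u⟩).2 with hc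
  have hs : (trivializationAt (EuclideanSpace ℝ (Fin n)) (TangentSpace (𝓡 n)) x).symmL ℝ y c =
      pullTangent n f y u := by
    rw [Trivialization.symmL_apply _ hy]
    exact Trivialization.symm_apply_apply_mk _ hy _
  have hG : (ContinuousLinearMap.adjoint (localDeriv n f x y) ∘L localDeriv n f x y) c =
      ContinuousLinearMap.adjoint (localDeriv n f x y) u := by
    refine ext_inner_right ℝ fun w => ?_
    rw [ContinuousLinearMap.comp_apply, ContinuousLinearMap.adjoint_inner_left,
      ContinuousLinearMap.adjoint_inner_left]
    simp only [localDeriv, ContinuousLinearMap.comp_apply]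
    rw [hs, hf.inner_eq, inner_pullTangent]
  rw [localPull, ContinuousLinearMap.comp_apply, ← hG, ← mul_apply_eq_comp,
    Ring.inverse_mul_cancel _ (hf.isUnit_gram hy), one_apply_eq_self]

theorem IsIsometricImmersion.contMDiffAt_localPull (hf : IsIsometricImmersion n f) (x : M) :
    ContMDiffAt (𝓡 n) 𝓘(ℝ, EuclideanSpace ℝ (Fin m) →L[ℝ] EuclideanSpace ℝ (Fin n)) ∞
      (localPull n f x) x := by
  have h1 : ContMDiffAt (𝓡 n) 𝓘(ℝ, EuclideanSpace ℝ (Fin n) →L[ℝ] EuclideanSpace ℝ (Fin m)) ∞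
    (localDeriv n f x) x := contMDiffAt_mvfderiv_comp_symmL x hf.smooth
  have h2 : ContMDiffAt (𝓡 n) 𝓘(ℝ, EuclideanSpace ℝ (Fin m) →L[ℝ] EuclideanSpace ℝ (Fin n)) ∞
    (fun y => ContinuousLinearMap.adjoint (localDeriv n f x y)) x :=
    contDiff_adjoint.contMDiff.contMDiffAt.comp x h1
  obtain ⟨U, hU⟩ := hf.isUnit_gram (mem_baseSet_trivializationAt' (F := EuclideanSpace ℝ (Fin n))
    (E := TangentSpace (𝓡 n)) x)
  have h3 : ContDiffAt ℝ ∞ Ring.inverse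
      (ContinuousLinearMap.adjoint (localDeriv n f x x) ∘L localDeriv n f x x) :=
    hU ▸ contDiffAt_ringInverse ℝ U
  exact (h3.contMDiffAt.comp x (h2.clm_comp h1)).clm_comp h2

theorem IsIsometricImmersion.isSmoothField_pullTangent (hf : IsIsometricImmersion n f)
    {u : M → EuclideanSpace ℝ (Fin m)} (hu : ContMDiff (𝓡 n) 𝓘(ℝ, EuclideanSpace ℝ (Fin m)) ∞ u) :
    IsSmoothField fun x => pullTangent n f x (u x) := by
  intro x
  rw [contMDiffAt_section]
  refine ((hf.contMDiffAt_localPull x).clm_apply (hu x)).congr_of_eventuallyEq ?_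
  filter_upwards [(trivializationAt (EuclideanSpace ℝ (Fin n)) (TangentSpace (𝓡 n)) x
    ).open_baseSet.mem_nhds (mem_baseSet_trivializationAt' x)] with y hy
  exact hf.trivializationAt_pullTangent hy (u y)

theorem IsIsometricImmersion.contMDiff_pushPull (hf : IsIsometricImmersion n f)
    {g : M → EuclideanSpace ℝ (Fin m)} (hg : ContMDiff (𝓡 n) 𝓘(ℝ, EuclideanSpace ℝ (Fin m)) ∞ g) :
    ContMDiff (𝓡 n) 𝓘(ℝ, EuclideanSpace ℝ (Fin m) →L[ℝ] EuclideanSpace ℝ (Fin m)) ∞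
      (pushPull n f g) := by
  intro x
  refine ((contMDiffAt_mvfderiv_comp_symmL x hg).clm_comp
    (hf.contMDiffAt_localPull x)).congr_of_eventuallyEq ?_
  filter_upwards [(trivializationAt (EuclideanSpace ℝ (Fin n)) (TangentSpace (𝓡 n)) x
    ).open_baseSet.mem_nhds (mem_baseSet_trivializationAt' x)] with y hy
  ext1 u
  rw [pushPull_apply, ContinuousLinearMap.comp_apply, ← hf.trivializationAt_pullTangent hy u,
    ContinuousLinearMap.comp_apply, Trivialization.symmL_apply _ hy]
  exact congrArg _ (Trivialization.symm_apply_apply_mk _ hy _).symm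

end Projection

/-! ### The normal projection and sections of the normal bundle. -/

section Normal

variable {n m : ℕ} {M : Type*} [TopologicalSpace M]
  [ChartedSpace (EuclideanSpace ℝ (Fin n)) M] {f : M → EuclideanSpace ℝ (Fin m)}

theorem inner_normal (x : M) (η : normalSpace n f x) (w : TangentSpace (𝓡 n) x) :
    ⟪(η : EuclideanSpace ℝ (Fin m)), mvfderiv (𝓡 n) f x w⟫_ℝ = 0 :=
  (Submodule.mem_orthogonal' _ _).1 η.2 _ ⟨w, rfl⟩

theorem normalPart_mvfderiv (x : M) (w : TangentSpace (𝓡 n) x) :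
    normalPart n f x (mvfderiv (𝓡 n) f x w) = 0 :=
  Submodule.orthogonalProjectionOnto_orthogonal_apply_eq_zero ⟨w, rfl⟩

theorem normalPart_normal (x : M) (η : normalSpace n f x) : normalPart n f x η = η :=
  Submodule.orthogonalProjectionOnto_mem_subspace_eq_self η

theorem inner_normalPart (x : M) (u : EuclideanSpace ℝ (Fin m)) (η : normalSpace n f x) :
    ⟪normalPart n f x u, η⟫_ℝ = ⟪u, (η : EuclideanSpace ℝ (Fin m))⟫_ℝ :=
  Submodule.inner_orthogonalProjectionOnto_eq_of_mem_right η u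

theorem normalPart_add (x : M) (u w : EuclideanSpace ℝ (Fin m)) :
    normalPart n f x (u + w) = normalPart n f x u + normalPart n f x w := map_add _ u w

theorem normalPart_sub (x : M) (u w : EuclideanSpace ℝ (Fin m)) :
    normalPart n f x (u - w) = normalPart n f x u - normalPart n f x w := map_sub _ u w

theorem normalPart_neg (x : M) (u : EuclideanSpace ℝ (Fin m)) :
    normalPart n f x (-u) = -normalPart n f x u := map_neg _ u

theorem normalPart_smul (x : M) (c : ℝ) (u : EuclideanSpace ℝ (Fin m)) :
    normalPart n f x (c • u) = c • normalPart n f x u := map_smul _ c u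

theorem IsSmoothNormal.mdifferentiableAt {η : ∀ x, normalSpace n f x} (hη : IsSmoothNormal n f η)
    (x : M) : MDifferentiableAt (𝓡 n) 𝓘(ℝ, EuclideanSpace ℝ (Fin m))
      (fun y => (η y : EuclideanSpace ℝ (Fin m))) x :=
  (hη x).mdifferentiableAt (by simp)

theorem IsSmoothField.mdifferentiableAt [IsManifold (𝓡 n) ∞ M]
    {X : ∀ x : M, TangentSpace (𝓡 n) x} (hX : IsSmoothField X) (x : M) :
    MDifferentiableAt (𝓡 n) (𝓡 n).tangent (fun x => (⟨x, X x⟩ : TangentBundle (𝓡 n) M)) x :=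
  (hX x).mdifferentiableAt (by simp)

theorem mvfderiv_inner_normal {η ξ : ∀ x, normalSpace n f x} (hη : IsSmoothNormal n f η)
    (hξ : IsSmoothNormal n f ξ) {x : M} (v : TangentSpace (𝓡 n) x) :
    mvfderiv (𝓡 n) (fun y => ⟪η y, ξ y⟫_ℝ) x v =
      ⟪normalConn f v η, ξ x⟫_ℝ + ⟪η x, normalConn f v ξ⟫_ℝ := by
  have h := mvfderiv_inner (hη.mdifferentiableAt x) (hξ.mdifferentiableAt x) v
  rw [normalConn, normalConn, inner_normalPart, real_inner_comm (normalPart n f x _),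
    inner_normalPart, real_inner_comm (η x : EuclideanSpace ℝ (Fin m))]
  exact h

end Normal

/-! ### The Gauss and Weingarten formulas for `f`. -/

section Immersion

variable {n m : ℕ} {M : Type*} [TopologicalSpace M]
  [ChartedSpace (EuclideanSpace ℝ (Fin n)) M]
  [RiemannianBundle (fun x : M => TangentSpace (𝓡 n) x)]
  {f : M → EuclideanSpace ℝ (Fin m)}

theorem inner_shape {b : ∀ x : M, TangentSpace (𝓡 n) x → TangentSpace (𝓡 n) x → normalSpace n f x}
    {x : M} (hb : IsBilinearMap ℝ (b x)) (ξ : normalSpace n f x) (v w : TangentSpace (𝓡 n) x) :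
    ⟪shape b x ξ v, w⟫_ℝ = ⟪b x v w, ξ⟫_ℝ :=
  inner_riesz (φ := fun w => ⟪b x v w, ξ⟫_ℝ)
    ⟨fun a c => by rw [hb.add_right, inner_add_left],
      fun c a => by rw [hb.smul_right, real_inner_smul_left, smul_eq_mul]⟩ w

theorem shape_eq {b : ∀ x : M, TangentSpace (𝓡 n) x → TangentSpace (𝓡 n) x → normalSpace n f x}
    {x : M} {ξ : normalSpace n f x} {v u : TangentSpace (𝓡 n) x}
    (h : ∀ w, ⟪u, w⟫_ℝ = ⟪b x v w, ξ⟫_ℝ) : shape b x ξ v = u :=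
  riesz_eq h

theorem pullTangent_normal (x : M) (η : normalSpace n f x) :
    pullTangent n f x (η : EuclideanSpace ℝ (Fin m)) = 0 :=
  ext_inner_right ℝ fun w => by rw [inner_pullTangent, inner_zero_left, inner_normal]

namespace IsIsometricImmersion

theorem mvfderiv_pullTangent_add_normalPart (hf : IsIsometricImmersion n f) (x : M)
    (u : EuclideanSpace ℝ (Fin m)) :
    mvfderiv (𝓡 n) f x (pullTangent n f x u) + normalPart n f x u = u := by
  have h : u - mvfderiv (𝓡 n) f x (pullTangent n f x u) ∈ normalSpace n f x := by
    rw [Submodule.mem_orthogonal']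
    rintro _ ⟨w, rfl⟩
    have := hf.inner_eq x (pullTangent n f x u) w
    rw [inner_pullTangent] at this
    rw [inner_sub_left]
    exact sub_eq_zero.2 this.symm
  have h2 := normalPart_normal (f := f) x ⟨_, h⟩
  rw [normalPart_sub, normalPart_mvfderiv, sub_zero] at h2
  rw [h2, add_sub_cancel]

theorem coe_normalPart (hf : IsIsometricImmersion n f) (x : M)
    (u : EuclideanSpace ℝ (Fin m)) :
    (normalPart n f x u : EuclideanSpace ℝ (Fin m)) = u - pushPull n f f x u :=
  eq_sub_of_add_eq' (hf.mvfderiv_pullTangent_add_normalPart x u)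

variable [IsManifold (𝓡 n) ∞ M]

theorem isSmoothNormal_normalPart (hf : IsIsometricImmersion n f) {u : M → EuclideanSpace ℝ (Fin m)}
    (hu : ContMDiff (𝓡 n) 𝓘(ℝ, EuclideanSpace ℝ (Fin m)) ∞ u) :
    IsSmoothNormal n f fun x => normalPart n f x (u x) := by
  have h : ContMDiff (𝓡 n) 𝓘(ℝ, EuclideanSpace ℝ (Fin m)) ∞
      fun x => u x - pushPull n f f x (u x) :=
    hu.sub ((hf.contMDiff_pushPull hf.smooth).clm_apply hu)
  simpa only [IsSmoothNormal, hf.coe_normalPart] using h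

/-- Projecting the constant vector `f_* v` to every tangent space gives a global smooth field, so no
cutoff functions are needed. -/
theorem exists_isSmoothField (hf : IsIsometricImmersion n f) {x : M} (v : TangentSpace (𝓡 n) x) :
    ∃ X : ∀ x : M, TangentSpace (𝓡 n) x, IsSmoothField X ∧ X x = v :=
  ⟨_, hf.isSmoothField_pullTangent contMDiff_const, hf.pullTangent_mvfderiv x v⟩

theorem exists_isSmoothNormal (hf : IsIsometricImmersion n f) {x : M} (ξ : normalSpace n f x) :
    ∃ η : ∀ x, normalSpace n f x, IsSmoothNormal n f η ∧ η x = ξ :=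
  ⟨_, hf.isSmoothNormal_normalPart contMDiff_const, normalPart_normal x ξ⟩

/-- Writing each metric product as `⟪f_* ·, f_* ·⟫` and each bracket as a commutator of derivatives
of `f_*`, all Koszul terms cancel except `⟪∇̃_v f_*Y, f_*w⟫`. -/
theorem leviCivita_eq (hf : IsIsometricImmersion n f) {x : M}
    (v : TangentSpace (𝓡 n) x) {Y : ∀ x : M, TangentSpace (𝓡 n) x}
    (hY : MDifferentiableAt (𝓡 n) (𝓡 n).tangent
      (fun x => (⟨x, Y x⟩ : TangentBundle (𝓡 n) M)) x) :
    leviCivita v Y =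
      pullTangent n f x (mvfderiv (𝓡 n) (fun y => mvfderiv (𝓡 n) f y (Y y)) x v) := by
  refine riesz_eq fun w => ?_
  have hv := mdifferentiableAt_extend (𝓡 n) (EuclideanSpace ℝ (Fin n)) v
  have hw := mdifferentiableAt_extend (𝓡 n) (EuclideanSpace ℝ (Fin n)) w
  have hv' := mdifferentiableAt_mvfderiv_apply hf.smooth hv
  have hw' := mdifferentiableAt_mvfderiv_apply hf.smooth hw
  have hY' := mdifferentiableAt_mvfderiv_apply hf.smooth hY
  rw [inner_pullTangent]
  simp only [koszul, ← hf.inner_eq]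
  rw [mvfderiv_inner hY' hw', mvfderiv_inner hv' hw', mvfderiv_inner hv' hY',
    mvfderiv_mlieBracket hf.smooth hv hY, mvfderiv_mlieBracket hf.smooth hv hw,
    mvfderiv_mlieBracket hf.smooth hY hw]
  simp only [extend_apply_self, inner_sub_left]
  simp only [real_inner_comm]
  ring

/-- Differentiate `P f_*Y = f_*Y` with `P` the tangential projection: the term `P(∇̃_v f_*Y)` has no
normal part. What remains depends only on `Y x`, which makes `α` tensorial. -/
theorem normalPart_mvfderiv_mvfderiv (hf : IsIsometricImmersion n f) {x : M}
    (v : TangentSpace (𝓡 n) x) {Y : ∀ x : M, TangentSpace (𝓡 n) x}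
    (hY : MDifferentiableAt (𝓡 n) (𝓡 n).tangent
      (fun x => (⟨x, Y x⟩ : TangentBundle (𝓡 n) M)) x) :
    normalPart n f x (mvfderiv (𝓡 n) (fun y => mvfderiv (𝓡 n) f y (Y y)) x v) =
      normalPart n f x (mvfderiv (𝓡 n) (pushPull n f f) x v (mvfderiv (𝓡 n) f x (Y x))) := by
  have h := mvfderiv_clm_apply
    ((hf.contMDiff_pushPull hf.smooth x).mdifferentiableAt (by simp))
    (mdifferentiableAt_mvfderiv_apply hf.smooth hY) v
  simp only [pushPull_apply, hf.pullTangent_mvfderiv] at h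
  conv_lhs => rw [h]
  rw [normalPart_add, normalPart_mvfderiv, add_zero]

theorem sff_eq (hf : IsIsometricImmersion n f) (x : M) (v w : TangentSpace (𝓡 n) x) :
    sff f x v w =
      normalPart n f x (mvfderiv (𝓡 n) (pushPull n f f) x v (mvfderiv (𝓡 n) f x w)) := by
  have h := hf.normalPart_mvfderiv_mvfderiv v
    (mdifferentiableAt_extend (𝓡 n) (EuclideanSpace ℝ (Fin n)) w)
  rw [extend_apply_self] at h
  exact h

theorem isBilinearMap_sff (hf : IsIsometricImmersion n f) (x : M) : IsBilinearMap ℝ (sff (n := n) f x) where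
  add_left v v' w := by simp only [hf.sff_eq, map_add, _root_.add_apply, normalPart_add]
  smul_left c v w := by simp only [hf.sff_eq, map_smul, _root_.smul_apply, normalPart_smul]
  add_right v w w' := by simp only [hf.sff_eq, map_add, normalPart_add]
  smul_right c v w := by simp only [hf.sff_eq, map_smul, normalPart_smul]

/-- The Gauss formula. -/
theorem mvfderiv_mvfderiv_eq (hf : IsIsometricImmersion n f) {x : M}
    (v : TangentSpace (𝓡 n) x) {Y : ∀ x : M, TangentSpace (𝓡 n) x}
    (hY : MDifferentiableAt (𝓡 n) (𝓡 n).tangent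
      (fun x => (⟨x, Y x⟩ : TangentBundle (𝓡 n) M)) x) :
    mvfderiv (𝓡 n) (fun y => mvfderiv (𝓡 n) f y (Y y)) x v =
      mvfderiv (𝓡 n) f x (leviCivita v Y) + sff f x v (Y x) := by
  rw [hf.leviCivita_eq v hY, hf.sff_eq, ← hf.normalPart_mvfderiv_mvfderiv v hY,
    hf.mvfderiv_pullTangent_add_normalPart]

theorem mlieBracket_eq (hf : IsIsometricImmersion n f) {x : M} {X Y : ∀ x : M, TangentSpace (𝓡 n) x}
    (hX : MDifferentiableAt (𝓡 n) (𝓡 n).tangent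
      (fun x => (⟨x, X x⟩ : TangentBundle (𝓡 n) M)) x)
    (hY : MDifferentiableAt (𝓡 n) (𝓡 n).tangent
      (fun x => (⟨x, Y x⟩ : TangentBundle (𝓡 n) M)) x) :
    VectorField.mlieBracket (𝓡 n) X Y x = leviCivita (X x) Y - leviCivita (Y x) X := by
  rw [← hf.pullTangent_mvfderiv x (VectorField.mlieBracket (𝓡 n) X Y x),
    mvfderiv_mlieBracket hf.smooth hX hY, map_sub, hf.leviCivita_eq _ hX, hf.leviCivita_eq _ hY]

theorem sff_symm (hf : IsIsometricImmersion n f) (x : M) (v w : TangentSpace (𝓡 n) x) :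
    sff f x v w = sff f x w v := by
  have h := congrArg (normalPart n f x) (mvfderiv_mlieBracket hf.smooth
    (mdifferentiableAt_extend (𝓡 n) (EuclideanSpace ℝ (Fin n)) v)
    (mdifferentiableAt_extend (𝓡 n) (EuclideanSpace ℝ (Fin n)) w))
  rw [normalPart_mvfderiv, normalPart_sub, extend_apply_self, extend_apply_self] at h
  exact (sub_eq_zero.1 h.symm)

/-- The Weingarten formula. -/
theorem mvfderiv_normal_eq (hf : IsIsometricImmersion n f) {x : M}
    (v : TangentSpace (𝓡 n) x) {η : ∀ x, normalSpace n f x}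
    (hη : IsSmoothNormal n f η) :
    mvfderiv (𝓡 n) (fun y => (η y : EuclideanSpace ℝ (Fin m))) x v =
      -mvfderiv (𝓡 n) f x (shape (sff f) x (η x) v) + normalConn f v η := by
  -- The tangential part is found by differentiating `⟪η, f_*W⟫ = 0`.
  have key : shape (sff f) x (η x) v =
      -pullTangent n f x (mvfderiv (𝓡 n) (fun y => (η y : EuclideanSpace ℝ (Fin m))) x v) := by
    refine shape_eq fun w => ?_
    have hw := mdifferentiableAt_extend (𝓡 n) (EuclideanSpace ℝ (Fin n)) w
    have h := mvfderiv_inner (hη.mdifferentiableAt x)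
      (mdifferentiableAt_mvfderiv_apply hf.smooth hw) v
    simp only [inner_normal, mvfderiv_const] at h
    rw [hf.mvfderiv_mvfderiv_eq v hw, inner_add_right, inner_normal, extend_apply_self] at h
    rw [inner_neg_left, inner_pullTangent, Submodule.coe_inner,
      real_inner_comm (η x : EuclideanSpace ℝ (Fin m))]
    simp only [zero_apply] at h
    linarith
  rw [key, map_neg, neg_neg]
  exact (hf.mvfderiv_pullTangent_add_normalPart x _).symm

end IsIsometricImmersion

end Immersion

/-! ### The rotation field `J` of a bending, and `β`, `𝓔` as components of `dJ`. -/

section Bending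

variable {n m : ℕ} {M : Type*} [TopologicalSpace M]
  [ChartedSpace (EuclideanSpace ℝ (Fin n)) M]
  [RiemannianBundle (fun x : M => TangentSpace (𝓡 n) x)]
  {f T : M → EuclideanSpace ℝ (Fin m)}

variable (n) in
/-- The skew-symmetric endomorphism of `ℝ^m` that extends `L = 𝓣_*` from the tangent space by `𝓨`
on the normal space. -/
def rotation (f T : M → EuclideanSpace ℝ (Fin m)) (x : M) :
    EuclideanSpace ℝ (Fin m) →L[ℝ] EuclideanSpace ℝ (Fin m) :=
  pushPull n f T x - ContinuousLinearMap.adjoint (pushPull n f T x) ∘L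
    (ContinuousLinearMap.id ℝ _ - pushPull n f f x)

theorem inner_calY (x : M) (η : normalSpace n f x) (w : TangentSpace (𝓡 n) x) :
    ⟪calY f T x η, w⟫_ℝ = -⟪(η : EuclideanSpace ℝ (Fin m)), mvfderiv (𝓡 n) T x w⟫_ℝ :=
  inner_riesz (φ := fun w => -⟪(η : EuclideanSpace ℝ (Fin m)), mvfderiv (𝓡 n) T x w⟫_ℝ)
    ⟨fun a c => by rw [map_add, inner_add_right, neg_add],
      fun c a => by rw [map_smul, real_inner_smul_right, smul_eq_mul, mul_neg]⟩ w

theorem rotation_normal (x : M) (η : normalSpace n f x) :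
    rotation n f T x η = mvfderiv (𝓡 n) f x (calY f T x η) := by
  have h : rotation n f T x η = -ContinuousLinearMap.adjoint (pushPull n f T x) η := by
    simp [rotation, pushPull_apply, pullTangent_normal]
  rw [h]
  refine ext_inner_right ℝ fun u => ?_
  rw [inner_neg_left, ContinuousLinearMap.adjoint_inner_left, pushPull_apply, ← inner_calY,
    real_inner_comm, inner_pullTangent, real_inner_comm]

namespace IsIsometricImmersion

theorem rotation_mvfderiv (hf : IsIsometricImmersion n f) (x : M) (v : TangentSpace (𝓡 n) x) :
    rotation n f T x (mvfderiv (𝓡 n) f x v) = mvfderiv (𝓡 n) T x v := by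
  simp [rotation, pushPull_apply, hf.pullTangent_mvfderiv]

/-- Checked blockwise: tangent-tangent is the bending condition, the mixed blocks are the definition
of `𝓨`, and normal-normal vanishes because `𝓨` has tangent values. -/
theorem inner_rotation (hf : IsIsometricImmersion n f) (hT : IsBending n f T) (x : M)
    (u w : EuclideanSpace ℝ (Fin m)) :
    ⟪rotation n f T x u, w⟫_ℝ + ⟪u, rotation n f T x w⟫_ℝ = 0 := by
  obtain ⟨a, ξ, rfl⟩ : ∃ a, ∃ ξ : normalSpace n f x, mvfderiv (𝓡 n) f x a + ξ = u :=
    ⟨_, _, hf.mvfderiv_pullTangent_add_normalPart x u⟩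
  obtain ⟨b, η, rfl⟩ : ∃ b, ∃ η : normalSpace n f x, mvfderiv (𝓡 n) f x b + η = w :=
    ⟨_, _, hf.mvfderiv_pullTangent_add_normalPart x w⟩
  have h := hT.skew x a b
  have h1 := inner_calY (T := T) x ξ b
  have h2 := inner_calY (T := T) x η a
  have h3 := inner_normal x ξ (calY f T x η)
  have h4 := inner_normal x η (calY f T x ξ)
  rw [← hf.inner_eq] at h1 h2
  rw [real_inner_comm] at h4
  rw [real_inner_comm, real_inner_comm _ (η : EuclideanSpace ℝ (Fin m))] at h2
  simp only [map_add, hf.rotation_mvfderiv, rotation_normal, inner_add_left, inner_add_right]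
  linarith

variable [IsManifold (𝓡 n) ∞ M]

theorem contMDiff_rotation (hf : IsIsometricImmersion n f)
    (hT : ContMDiff (𝓡 n) 𝓘(ℝ, EuclideanSpace ℝ (Fin m)) ∞ T) :
    ContMDiff (𝓡 n) 𝓘(ℝ, EuclideanSpace ℝ (Fin m) →L[ℝ] EuclideanSpace ℝ (Fin m)) ∞
      (rotation n f T) := by
  have h1 := hf.contMDiff_pushPull hT
  exact h1.sub ((contDiff_adjoint.contMDiff.comp h1).clm_comp
    (contMDiff_const.sub (hf.contMDiff_pushPull hf.smooth)))

theorem mdifferentiableAt_rotation (hf : IsIsometricImmersion n f) (hT : IsBending n f T) (x : M) :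
    MDifferentiableAt (𝓡 n) 𝓘(ℝ, EuclideanSpace ℝ (Fin m) →L[ℝ] EuclideanSpace ℝ (Fin m))
      (rotation n f T) x :=
  (hf.contMDiff_rotation hT.smooth x).mdifferentiableAt (by simp)

theorem inner_mvfderiv_rotation (hf : IsIsometricImmersion n f) (hT : IsBending n f T) (x : M)
    (v : TangentSpace (𝓡 n) x) (u w : EuclideanSpace ℝ (Fin m)) :
    ⟪mvfderiv (𝓡 n) (rotation n f T) x v u, w⟫_ℝ
      + ⟪u, mvfderiv (𝓡 n) (rotation n f T) x v w⟫_ℝ = 0 := by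
  have hJ := hf.mdifferentiableAt_rotation hT x
  have key (u w : EuclideanSpace ℝ (Fin m)) :
      mvfderiv (𝓡 n) (fun y => ⟪rotation n f T y u, w⟫_ℝ) x v =
        ⟪mvfderiv (𝓡 n) (rotation n f T) x v u, w⟫_ℝ := by
    rw [mvfderiv_inner (hJ.clm_apply mdifferentiableAt_const) mdifferentiableAt_const,
      mvfderiv_clm_apply hJ mdifferentiableAt_const]
    simp [mvfderiv_const]
  have h : (fun y => ⟪rotation n f T y u, w⟫_ℝ) = -fun y => ⟪rotation n f T y w, u⟫_ℝ := by
    funext y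
    have := hf.inner_rotation hT y u w
    rw [real_inner_comm _ u] at this
    rw [Pi.neg_apply]
    linarith
  have h2 := congrArg (fun g => mvfderiv (𝓡 n) g x v) h
  simp only [mvfderiv_neg, _root_.neg_apply, key] at h2
  rw [h2, real_inner_comm, neg_add_cancel]

/-- Differentiate `J f_*W = 𝓣_*W` and use the Gauss formula: `J f_*∇_v W` cancels against `L ∇_v W`,
and `J α(v, w)` is `𝓨 α(v, w)`. -/
theorem hessBending_eq (hf : IsIsometricImmersion n f) (hT : IsBending n f T) (x : M)
    (v w : TangentSpace (𝓡 n) x) :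
    hessBending T x v w = mvfderiv (𝓡 n) (rotation n f T) x v (mvfderiv (𝓡 n) f x w)
      + mvfderiv (𝓡 n) f x (calY f T x (sff f x v w)) := by
  have hw := mdifferentiableAt_extend (𝓡 n) (EuclideanSpace ℝ (Fin n)) w
  have h := mvfderiv_clm_apply (hf.mdifferentiableAt_rotation hT x)
    (mdifferentiableAt_mvfderiv_apply hf.smooth hw) v
  simp only [hf.rotation_mvfderiv] at h
  rw [hessBending, h, hf.mvfderiv_mvfderiv_eq v hw, map_add, hf.rotation_mvfderiv,
    rotation_normal, extend_apply_self]
  abel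

theorem hessBending_symm (hf : IsIsometricImmersion n f) (hT : IsBending n f T) (x : M)
    (v w : TangentSpace (𝓡 n) x) : hessBending T x v w = hessBending T x w v := by
  have hv := mdifferentiableAt_extend (𝓡 n) (EuclideanSpace ℝ (Fin n)) v
  have hw := mdifferentiableAt_extend (𝓡 n) (EuclideanSpace ℝ (Fin n)) w
  have h := mvfderiv_mlieBracket hT.smooth hv hw
  rw [hf.mlieBracket_eq hv hw, map_sub, extend_apply_self, extend_apply_self] at h
  rw [hessBending, hessBending, sub_eq_sub_iff_sub_eq_sub, h]

theorem inner_mvfderiv_rotation_mvfderiv (hf : IsIsometricImmersion n f) (hT : IsBending n f T)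
    (x : M) (v w z : TangentSpace (𝓡 n) x) :
    ⟪mvfderiv (𝓡 n) (rotation n f T) x v (mvfderiv (𝓡 n) f x w), mvfderiv (𝓡 n) f x z⟫_ℝ = 0 := by
  let C (v w z : TangentSpace (𝓡 n) x) : ℝ :=
    ⟪mvfderiv (𝓡 n) (rotation n f T) x v (mvfderiv (𝓡 n) f x w), mvfderiv (𝓡 n) f x z⟫_ℝ
  have hs (v w z) : C v w z = C w v z := by
    -- The summand with `𝓨 α(v, w)` is itself symmetric, so symmetry passes to the `dJ` term.
    have h := hf.hessBending_symm hT x v w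
    rw [hf.hessBending_eq hT, hf.hessBending_eq hT, hf.sff_symm x w v] at h
    simp only [C, add_right_cancel h]
  have ha (v w z) : C v w z = -C v z w := by
    have h := hf.inner_mvfderiv_rotation hT x v (mvfderiv (𝓡 n) f x w) (mvfderiv (𝓡 n) f x z)
    rw [real_inner_comm _ (mvfderiv (𝓡 n) f x w)] at h
    simp only [C]
    linarith
  change C v w z = 0
  -- Alternating the two symmetries six times returns to the same arguments with three sign changes,
  -- so `C v w z = -C v w z`.
  linarith [hs v w z, ha w v z, hs w z v, ha z w v, hs z v w, ha v z w]

theorem beta_eq (hf : IsIsometricImmersion n f) (hT : IsBending n f T) (x : M)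
    (v w : TangentSpace (𝓡 n) x) :
    beta n f T x v w =
      normalPart n f x (mvfderiv (𝓡 n) (rotation n f T) x v (mvfderiv (𝓡 n) f x w)) := by
  rw [beta, hf.hessBending_eq hT, normalPart_add, normalPart_mvfderiv, add_zero]

theorem mvfderiv_rotation_mvfderiv (hf : IsIsometricImmersion n f) (hT : IsBending n f T) (x : M)
    (v w : TangentSpace (𝓡 n) x) :
    mvfderiv (𝓡 n) (rotation n f T) x v (mvfderiv (𝓡 n) f x w) = beta n f T x v w := by
  have h : pullTangent n f x
      (mvfderiv (𝓡 n) (rotation n f T) x v (mvfderiv (𝓡 n) f x w)) = 0 :=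
    ext_inner_right ℝ fun z => by
      rw [inner_pullTangent, hf.inner_mvfderiv_rotation_mvfderiv hT, inner_zero_left]
  conv_lhs => rw [← hf.mvfderiv_pullTangent_add_normalPart x
    (mvfderiv (𝓡 n) (rotation n f T) x v (mvfderiv (𝓡 n) f x w))]
  rw [h, map_zero, zero_add, hf.beta_eq hT]

theorem isBilinearMap_beta (hf : IsIsometricImmersion n f) (hT : IsBending n f T) (x : M) :
    IsBilinearMap ℝ (beta n f T x) where
  add_left v v' w := by simp only [hf.beta_eq hT, map_add, _root_.add_apply, normalPart_add]
  smul_left c v w := by simp only [hf.beta_eq hT, map_smul, _root_.smul_apply, normalPart_smul]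
  add_right v w w' := by simp only [hf.beta_eq hT, map_add, normalPart_add]
  smul_right c v w := by simp only [hf.beta_eq hT, map_smul, normalPart_smul]

theorem beta_symm (hf : IsIsometricImmersion n f) (hT : IsBending n f T) (x : M)
    (v w : TangentSpace (𝓡 n) x) : beta n f T x v w = beta n f T x w v := by
  rw [beta, beta, hf.hessBending_symm hT]

/-- Extend `ξ` to a section `η` and take the normal part of the derivative of `J η = f_* 𝓨 η`. The
Weingarten formula produces `(L A_η v)_{N_f M}` on the left, the Gauss formula `α(v, 𝓨 η)` on the
right, and `J ∇^⊥_v η` is tangent. -/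
theorem calE_eq (hf : IsIsometricImmersion n f) (hT : IsBending n f T) (x : M)
    (v : TangentSpace (𝓡 n) x) (ξ : normalSpace n f x) :
    calE n f T x v ξ = normalPart n f x (mvfderiv (𝓡 n) (rotation n f T) x v ξ) := by
  obtain ⟨η, hη, rfl⟩ := hf.exists_isSmoothNormal ξ
  have hJη : ContMDiff (𝓡 n) 𝓘(ℝ, EuclideanSpace ℝ (Fin m)) ∞
      (fun y => rotation n f T y (η y)) := (hf.contMDiff_rotation hT.smooth).clm_apply hη
  have hW := (hf.isSmoothField_pullTangent hJη).mdifferentiableAt x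
  have h := mvfderiv_clm_apply (hf.mdifferentiableAt_rotation hT x) (hη.mdifferentiableAt x) v
  have h2 := hf.mvfderiv_mvfderiv_eq v hW
  simp only [rotation_normal, hf.pullTangent_mvfderiv] at h h2
  rw [h, hf.mvfderiv_normal_eq v hη, map_add, map_neg, hf.rotation_mvfderiv,
    rotation_normal] at h2
  have h3 := congrArg (normalPart n f x) h2
  simp only [normalPart_add, normalPart_neg, normalPart_mvfderiv, normalPart_normal, zero_add,
    add_zero] at h3
  rw [calE, ← h3]
  abel

/-- The tangential part is forced by the skewness of `dJ(v)` together with `dJ(v) f_*w = β(v, w)`.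
-/
theorem mvfderiv_rotation_normal (hf : IsIsometricImmersion n f) (hT : IsBending n f T) (x : M)
    (v : TangentSpace (𝓡 n) x) (ξ : normalSpace n f x) :
    mvfderiv (𝓡 n) (rotation n f T) x v ξ =
      -mvfderiv (𝓡 n) f x (shape (beta n f T) x ξ v) + calE n f T x v ξ := by
  have h : shape (beta n f T) x ξ v =
      -pullTangent n f x (mvfderiv (𝓡 n) (rotation n f T) x v ξ) := by
    refine shape_eq fun w => ?_
    have h := hf.inner_mvfderiv_rotation hT x v (mvfderiv (𝓡 n) f x w) ξ
    rw [hf.mvfderiv_rotation_mvfderiv hT, real_inner_comm _ (mvfderiv (𝓡 n) f x w)] at h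
    rw [inner_neg_left, inner_pullTangent, Submodule.coe_inner]
    linarith
  rw [h, map_neg, neg_neg, hf.calE_eq hT, hf.mvfderiv_pullTangent_add_normalPart]

theorem isCompatiblePair (hf : IsIsometricImmersion n f) (hT : IsBending n f T) :
    IsCompatiblePair (beta n f T) (calE n f T) where
  bilin_b := hf.isBilinearMap_beta hT
  bilin_e x :=
    { add_left := fun v v' w => by
        simp only [hf.calE_eq hT, map_add, _root_.add_apply, normalPart_add]
      smul_left := fun c v w => by
        simp only [hf.calE_eq hT, map_smul, _root_.smul_apply, normalPart_smul]
      add_right := fun v w w' => by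
        simp only [hf.calE_eq hT, Submodule.coe_add, map_add, normalPart_add]
      smul_right := fun c v w => by
        simp only [hf.calE_eq hT, Submodule.coe_smul, map_smul, normalPart_smul] }
  smooth_b X Y hX hY := by
    simp only [hf.beta_eq hT]
    exact hf.isSmoothNormal_normalPart ((contMDiff_mvfderiv_apply
      (hf.contMDiff_rotation hT.smooth) hX).clm_apply (contMDiff_mvfderiv_apply hf.smooth hY))
  smooth_e X η hX hη := by
    simp only [hf.calE_eq hT]
    exact hf.isSmoothNormal_normalPart ((contMDiff_mvfderiv_apply
      (hf.contMDiff_rotation hT.smooth) hX).clm_apply hη)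
  symm := hf.beta_symm hT
  anti x v η ξ := by
    rw [hf.calE_eq hT, hf.calE_eq hT, inner_normalPart, inner_normalPart,
      real_inner_comm (η : EuclideanSpace ℝ (Fin m)), hf.inner_mvfderiv_rotation hT]

end IsIsometricImmersion

end Bending

/-! ### Closedness of `dJ` and the fundamental equations. -/

section Equations

variable {n m : ℕ} {M : Type*} [TopologicalSpace M]
  [ChartedSpace (EuclideanSpace ℝ (Fin n)) M]
  [RiemannianBundle (fun x : M => TangentSpace (𝓡 n) x)] [IsManifold (𝓡 n) ∞ M]
  {f T : M → EuclideanSpace ℝ (Fin m)}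

namespace IsIsometricImmersion

theorem mvfderiv_mvfderiv_rotation_sub (hf : IsIsometricImmersion n f) (hT : IsBending n f T)
    {X Y : ∀ x : M, TangentSpace (𝓡 n) x} (hX : IsSmoothField X) (hY : IsSmoothField Y) (x : M) :
    mvfderiv (𝓡 n) (fun y => mvfderiv (𝓡 n) (rotation n f T) y (Y y)) x (X x)
        - mvfderiv (𝓡 n) (fun y => mvfderiv (𝓡 n) (rotation n f T) y (X y)) x (Y x) =
      mvfderiv (𝓡 n) (rotation n f T) x (leviCivita (X x) Y)
        - mvfderiv (𝓡 n) (rotation n f T) x (leviCivita (Y x) X) := by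
  rw [← mvfderiv_mlieBracket (hf.contMDiff_rotation hT.smooth) (hX.mdifferentiableAt x)
    (hY.mdifferentiableAt x), hf.mlieBracket_eq (hX.mdifferentiableAt x) (hY.mdifferentiableAt x),
    map_sub]

/-- Derivative of `dJ(Y) f_*Z = β(Y, Z)` along `X`. The term with `∇_X Y` is kept apart: it cancels
against the right side of the closedness identity. -/
theorem mvfderiv_mvfderiv_rotation_mvfderiv (hf : IsIsometricImmersion n f)
    (hT : IsBending n f T) {X Y Z : ∀ x : M, TangentSpace (𝓡 n) x}
    (hY : IsSmoothField Y) (hZ : IsSmoothField Z) (x : M) :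
    mvfderiv (𝓡 n) (fun y => mvfderiv (𝓡 n) (rotation n f T) y (Y y)) x (X x)
        (mvfderiv (𝓡 n) f x (Z x)) =
      mvfderiv (𝓡 n) f x (shape (beta n f T) x (sff f x (X x) (Z x)) (Y x)
          - shape (sff f) x (beta n f T x (Y x) (Z x)) (X x))
        + (covB (beta n f T) X Y Z x + beta n f T x (leviCivita (X x) Y) (Z x)
          - calE n f T x (Y x) (sff f x (X x) (Z x)) : normalSpace n f x) := by
  have hΩ := mdifferentiableAt_mvfderiv_apply (hf.contMDiff_rotation hT.smooth)
    (hY.mdifferentiableAt x)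
  have h := mvfderiv_clm_apply hΩ
    (mdifferentiableAt_mvfderiv_apply hf.smooth (hZ.mdifferentiableAt x)) (X x)
  simp only [hf.mvfderiv_rotation_mvfderiv hT] at h
  rw [hf.mvfderiv_normal_eq (X x) ((hf.isCompatiblePair hT).smooth_b Y Z hY hZ),
    hf.mvfderiv_mvfderiv_eq _ (hZ.mdifferentiableAt x), map_add, hf.mvfderiv_rotation_mvfderiv hT,
    hf.mvfderiv_rotation_normal hT] at h
  rw [eq_sub_of_add_eq h.symm]
  simp only [covB, map_sub, Submodule.coe_add, Submodule.coe_sub]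
  abel

/-- Normal part of the derivative of `dJ(Y) η = -f_* B_η Y + 𝓔(Y, η)` along `X`. -/
theorem normalPart_mvfderiv_mvfderiv_rotation (hf : IsIsometricImmersion n f)
    (hT : IsBending n f T) {X Y : ∀ x : M, TangentSpace (𝓡 n) x} {η : ∀ x, normalSpace n f x}
    (hY : IsSmoothField Y) (hη : IsSmoothNormal n f η) (x : M) :
    normalPart n f x (mvfderiv (𝓡 n) (fun y => mvfderiv (𝓡 n) (rotation n f T) y (Y y)) x (X x)
        (η x)) =
      covE (calE n f T) X Y η x + calE n f T x (leviCivita (X x) Y) (η x)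
        - sff f x (X x) (shape (beta n f T) x (η x) (Y x))
        + beta n f T x (Y x) (shape (sff f) x (η x) (X x)) := by
  have hΩ := contMDiff_mvfderiv_apply (hf.contMDiff_rotation hT.smooth) hY
  have hc := (hf.isCompatiblePair hT).smooth_e Y η hY hη
  -- `B_η Y` is smooth, being the tangential part of `-dJ(Y) η`.
  have hB : IsSmoothField fun y => shape (beta n f T) y (η y) (Y y) := by
    have h (y : M) : shape (beta n f T) y (η y) (Y y) =
        pullTangent n f y (-mvfderiv (𝓡 n) (rotation n f T) y (Y y) (η y)) := by
      rw [hf.mvfderiv_rotation_normal hT, neg_add, neg_neg, map_add, hf.pullTangent_mvfderiv,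
        map_neg, pullTangent_normal, neg_zero, add_zero]
    simp only [h]
    exact hf.isSmoothField_pullTangent (hΩ.clm_apply hη).neg
  have hB' := mdifferentiableAt_mvfderiv_apply hf.smooth (hB.mdifferentiableAt x)
  have h := mvfderiv_clm_apply ((hΩ x).mdifferentiableAt (by simp)) (hη.mdifferentiableAt x) (X x)
  simp only [hf.mvfderiv_rotation_normal hT] at h
  have hB'' : MDifferentiableAt (𝓡 n) 𝓘(ℝ, EuclideanSpace ℝ (Fin m))
      (fun y => -mvfderiv (𝓡 n) f y (shape (beta n f T) y (η y) (Y y))) x := hB'.neg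
  rw [mvfderiv_fun_add hB'' (hc.mdifferentiableAt x), mvfderiv_fun_neg, _root_.add_apply,
    _root_.neg_apply, hf.mvfderiv_mvfderiv_eq _ (hB.mdifferentiableAt x),
    hf.mvfderiv_normal_eq (X x) hc,
    hf.mvfderiv_normal_eq (X x) hη, map_add, map_neg, hf.mvfderiv_rotation_mvfderiv hT,
    hf.mvfderiv_rotation_normal hT] at h
  have h2 := congrArg (normalPart n f x) (eq_sub_of_add_eq h.symm)
  simp only [normalPart_add, normalPart_sub, normalPart_neg, normalPart_mvfderiv,
    normalPart_normal] at h2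
  rw [h2, covE]
  abel

/-- Closedness of `dJ` evaluated on `f_*Z`, split so that projecting to the tangent and the normal
space yields (1) and (2). -/
theorem gauss_codazzi (hf : IsIsometricImmersion n f) (hT : IsBending n f T)
    {X Y Z : ∀ x : M, TangentSpace (𝓡 n) x} (hX : IsSmoothField X) (hY : IsSmoothField Y)
    (hZ : IsSmoothField Z) (x : M) :
    mvfderiv (𝓡 n) f x (shape (beta n f T) x (sff f x (X x) (Z x)) (Y x)
          - shape (sff f) x (beta n f T x (Y x) (Z x)) (X x)
          - (shape (beta n f T) x (sff f x (Y x) (Z x)) (X x)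
          - shape (sff f) x (beta n f T x (X x) (Z x)) (Y x)))
        + (covB (beta n f T) X Y Z x - covB (beta n f T) Y X Z x
          - (calE n f T x (Y x) (sff f x (X x) (Z x))
          - calE n f T x (X x) (sff f x (Y x) (Z x))) : normalSpace n f x) = 0 := by
  have h := DFunLike.congr_fun (hf.mvfderiv_mvfderiv_rotation_sub hT hX hY x)
    (mvfderiv (𝓡 n) f x (Z x))
  rw [_root_.sub_apply, _root_.sub_apply, hf.mvfderiv_mvfderiv_rotation_mvfderiv hT hY hZ,
    hf.mvfderiv_mvfderiv_rotation_mvfderiv hT hX hZ, hf.mvfderiv_rotation_mvfderiv hT,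
    hf.mvfderiv_rotation_mvfderiv hT, ← sub_eq_zero] at h
  rw [← h]
  simp only [map_sub, Submodule.coe_add, Submodule.coe_sub]
  abel

theorem gaussEq (hf : IsIsometricImmersion n f) (hT : IsBending n f T) :
    GaussEq (beta n f T) := by
  intro X Y Z hX hY hZ x
  have h := congrArg (pullTangent n f x) (hf.gauss_codazzi hT hX hY hZ x)
  rw [map_add, hf.pullTangent_mvfderiv, pullTangent_normal, map_zero, add_zero] at h
  rw [← sub_eq_zero, ← neg_eq_zero, ← h]
  abel

theorem codazziEq (hf : IsIsometricImmersion n f) (hT : IsBending n f T) :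
    CodazziEq (beta n f T) (calE n f T) := by
  intro X Y Z hX hY hZ x
  have h := congrArg (normalPart n f x) (hf.gauss_codazzi hT hX hY hZ x)
  rw [normalPart_add, normalPart_mvfderiv, normalPart_normal, zero_add] at h
  refine sub_eq_zero.1 (h.trans ?_)
  exact map_zero _

theorem ricciEq (hf : IsIsometricImmersion n f) (hT : IsBending n f T) :
    RicciEq (beta n f T) (calE n f T) := by
  intro X Y η hX hY hη x
  have h := congrArg (normalPart n f x)
    (DFunLike.congr_fun (hf.mvfderiv_mvfderiv_rotation_sub hT hX hY x)
      (η x : EuclideanSpace ℝ (Fin m)))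
  rw [_root_.sub_apply, _root_.sub_apply, normalPart_sub, normalPart_sub,
    hf.normalPart_mvfderiv_mvfderiv_rotation hT hY hη,
    hf.normalPart_mvfderiv_mvfderiv_rotation hT hX hη, ← hf.calE_eq hT, ← hf.calE_eq hT,
    hf.beta_symm hT x (Y x), hf.sff_symm x (Y x), ← sub_eq_zero] at h
  rw [← sub_eq_zero, ← h]
  abel

end IsIsometricImmersion

/-! ### Duality between the two forms of the Codazzi equation, for an arbitrary pair. -/

section Equivalence

variable
  {b : ∀ x : M, TangentSpace (𝓡 n) x → TangentSpace (𝓡 n) x → normalSpace n f x}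
  {e : ∀ x : M, TangentSpace (𝓡 n) x → normalSpace n f x → normalSpace n f x}

theorem IsCompatiblePair.isSmoothField_shape (hb : IsCompatiblePair b e)
    (hf : IsIsometricImmersion n f) {Y : ∀ x : M, TangentSpace (𝓡 n) x}
    {η : ∀ x, normalSpace n f x} (hY : IsSmoothField Y) (hη : IsSmoothNormal n f η) :
    IsSmoothField fun x => shape b x (η x) (Y x) := by
  let o := stdOrthonormalBasis ℝ (EuclideanSpace ℝ (Fin m))
  -- With no `J` available, expand `f_* S_η Y` in a fixed orthonormal basis of `ℝ^m`: its
  -- coefficient along `o i` is `⟪b(Y, (o i)^⊤), η⟫`, which is smooth because `(o i)^⊤` is a smooth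
  -- field.
  have h (y : M) : shape b y (η y) (Y y) =
      pullTangent n f y (∑ i, ⟪(b y (Y y) (pullTangent n f y (o i)) : EuclideanSpace ℝ (Fin m)),
        (η y : EuclideanSpace ℝ (Fin m))⟫_ℝ • o i) := by
    rw [← hf.pullTangent_mvfderiv y (shape b y (η y) (Y y))]
    congr 1
    rw [← o.sum_repr' (mvfderiv (𝓡 n) f y (shape b y (η y) (Y y)))]
    refine Finset.sum_congr rfl fun i _ => ?_
    rw [← inner_pullTangent, real_inner_comm, inner_shape (hb.bilin_b y), Submodule.coe_inner]
  simp only [h]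
  refine hf.isSmoothField_pullTangent (contMDiff_finsetSum fun i _ => ?_)
  have h1 := hb.smooth_b Y _ hY (hf.isSmoothField_pullTangent (contMDiff_const (c := o i)))
  have h2 : ContMDiff (𝓡 n) 𝓘(ℝ, ℝ) ∞ fun y =>
      ⟪(b y (Y y) (pullTangent n f y (o i)) : EuclideanSpace ℝ (Fin m)),
        (η y : EuclideanSpace ℝ (Fin m))⟫_ℝ :=
    contDiff_inner.contMDiff.comp (h1.prodMk_space hη)
  exact h2.smul contMDiff_const

theorem IsIsometricImmersion.mvfderiv_inner_field (hf : IsIsometricImmersion n f)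
    {Y Z : ∀ x : M, TangentSpace (𝓡 n) x} (hY : IsSmoothField Y) (hZ : IsSmoothField Z) {x : M}
    (v : TangentSpace (𝓡 n) x) :
    mvfderiv (𝓡 n) (fun y => ⟪Y y, Z y⟫_ℝ) x v =
      ⟪leviCivita v Y, Z x⟫_ℝ + ⟪Y x, leviCivita v Z⟫_ℝ := by
  have h := mvfderiv_inner (mdifferentiableAt_mvfderiv_apply hf.smooth (hY.mdifferentiableAt x))
    (mdifferentiableAt_mvfderiv_apply hf.smooth (hZ.mdifferentiableAt x)) v
  rw [real_inner_comm _ (mvfderiv (𝓡 n) f x (Y x)), ← inner_pullTangent f, ← inner_pullTangent f,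
    ← hf.leviCivita_eq v (hY.mdifferentiableAt x),
    ← hf.leviCivita_eq v (hZ.mdifferentiableAt x)] at h
  simp only [hf.inner_eq] at h
  rw [h, real_inner_comm (Y x)]

/-- Two expansions of the derivative of `⟪b(Y, Z), η⟫ = ⟪S_η Y, Z⟫` along `X`, by compatibility of
`∇^⊥` and of `∇` with the metrics. -/
theorem IsCompatiblePair.inner_covB (hb : IsCompatiblePair b e)
    (hf : IsIsometricImmersion n f) {X Y Z : ∀ x : M, TangentSpace (𝓡 n) x}
    {η : ∀ x, normalSpace n f x} (hY : IsSmoothField Y) (hZ : IsSmoothField Z)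
    (hη : IsSmoothNormal n f η) (x : M) :
    ⟪covB b X Y Z x, η x⟫_ℝ =
      ⟪covShape b X Y η x - shape b x (normalConn f (X x) η) (Y x), Z x⟫_ℝ := by
  have h1 := mvfderiv_inner_normal (hb.smooth_b Y Z hY hZ) hη (X x)
  have h2 := hf.mvfderiv_inner_field (hb.isSmoothField_shape hf hY hη) hZ (X x)
  simp only [inner_shape (hb.bilin_b _)] at h2
  rw [covB, covShape]
  simp only [inner_sub_left, inner_shape (hb.bilin_b _)]
  linarith

theorem IsCompatiblePair.inner_codazzi (hb : IsCompatiblePair b e)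
    (hf : IsIsometricImmersion n f) {X Y Z : ∀ x : M, TangentSpace (𝓡 n) x}
    {η : ∀ x, normalSpace n f x} (hX : IsSmoothField X) (hY : IsSmoothField Y)
    (hZ : IsSmoothField Z) (hη : IsSmoothNormal n f η) (x : M) :
    ⟪covB b X Y Z x - covB b Y X Z x
      - (e x (Y x) (sff f x (X x) (Z x)) - e x (X x) (sff f x (Y x) (Z x))), η x⟫_ℝ =
    ⟪covShape b X Y η x - covShape b Y X η x
        - shape b x (normalConn f (X x) η) (Y x) + shape b x (normalConn f (Y x) η) (X x)
      - (shape (sff f) x (e x (X x) (η x)) (Y x) - shape (sff f) x (e x (Y x) (η x)) (X x)),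
      Z x⟫_ℝ := by
  have h1 := hb.inner_covB hf (X := X) hY hZ hη x
  have h2 := hb.inner_covB hf (X := Y) hX hZ hη x
  -- Antisymmetry moves `e` onto `η`: `⟪e(Y, α(X, Z)), η⟫ = -⟪α(X, Z), e(Y, η)⟫ = -⟪A_{e(Y, η)} X,
  -- Z⟫`.
  have h3 := hb.anti x (Y x) (sff f x (X x) (Z x)) (η x)
  have h4 := hb.anti x (X x) (sff f x (Y x) (Z x)) (η x)
  rw [real_inner_comm (sff f x (X x) (Z x))] at h3
  rw [real_inner_comm (sff f x (Y x) (Z x))] at h4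
  simp only [inner_sub_left, inner_add_left, inner_shape (hf.isBilinearMap_sff x)] at h1 h2 ⊢
  linarith

theorem IsCompatiblePair.codazziEq_iff (hb : IsCompatiblePair b e)
    (hf : IsIsometricImmersion n f) : CodazziEq b e ↔ CodazziShapeEq b e := by
  constructor
  · intro h X Y η hX hY hη x
    refine sub_eq_zero.1 (ext_inner_right ℝ fun z => ?_)
    obtain ⟨Z, hZ, rfl⟩ := hf.exists_isSmoothField z
    rw [← hb.inner_codazzi hf hX hY hZ hη, sub_eq_zero.2 (h X Y Z hX hY hZ x), inner_zero_left,
      inner_zero_left]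
  · intro h X Y Z hX hY hZ x
    refine sub_eq_zero.1 (ext_inner_right ℝ fun ξ => ?_)
    obtain ⟨η, hη, rfl⟩ := hf.exists_isSmoothNormal ξ
    rw [hb.inner_codazzi hf hX hY hZ hη, sub_eq_zero.2 (h X Y η hX hY hη x), inner_zero_left,
      inner_zero_left]

end Equivalence

end Equations

end InfinitesimalBending

end

theorem mainTheorem2 {n m : ℕ} {M : Type*} [TopologicalSpace M]
    [ChartedSpace (EuclideanSpace ℝ (Fin n)) M] [IsManifold (𝓡 n) ∞ M]
    [RiemannianBundle (fun x : M => TangentSpace (𝓡 n) x)]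
    [IsContMDiffRiemannianBundle (𝓡 n) ∞ (EuclideanSpace ℝ (Fin n))
      (fun x : M => TangentSpace (𝓡 n) x)]
    (f T : M → EuclideanSpace ℝ (Fin m))
    (hf : IsIsometricImmersion n f)
    (hT : IsBending n f T) :
    IsCompatiblePair
        (beta n f T) (calE n f T) ∧
      GaussEq (beta n f T) ∧
      CodazziEq
        (beta n f T) (calE n f T) ∧
      RicciEq
        (beta n f T) (calE n f T) ∧
      (CodazziEq
          (beta n f T) (calE n f T) ↔
        CodazziShapeEq
          (beta n f T) (calE n f T)) ∧
      ∀ (b : ∀ x : M, TangentSpace (𝓡 n) x → TangentSpace (𝓡 n) x →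
            normalSpace n f x)
        (e : ∀ x : M, TangentSpace (𝓡 n) x → normalSpace n f x →
            normalSpace n f x),
        IsCompatiblePair b e →
          (CodazziEq b e ↔ CodazziShapeEq b e) := by
  have h := hf.isCompatiblePair hT
  exact ⟨h, hf.gaussEq hT, hf.codazziEq hT, hf.ricciEq hT, h.codazziEq_iff hf,
    fun b e hbe => hbe.codazziEq_iff hf⟩
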